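/- Let $R$ be a complete local Noetherian commutative ring, let $\Lambda$ be a Noetherian $R$-algebra (an associative unital, not necessarily commutative, $R$-algebra which is finitely generated as an $R$-module), let $\mathfrak a$ be a proper ideal of $R$, and put $\overline\Lambda = \Lambda/\mathfrak a\Lambda$. Modules are right modules. For a ring $A$, let $D(A)$ denote the derived category of $A$-modules. An object of $D(A)$ is called perfect if it is isomorphic in $D(A)$ to a bounded complex of finitely generated projective $A$-modules. For $X, Y \in D(A)$ write $X \geq Y$ if $\operatorname{Hom}_{D(A)}(X, Y[i]) = 0$ for every integer $i > 0$. A perfect complex $X$ is called presilting if $X \geq X$. Assume that $\operatorname{Tor}_i^R(\Lambda, R/\mathfrak a^n) = 0$ for all integers $i > 0$ and $n > 0$. Then for every perfect complex $P \in D(\overline\Lambda)$ with $P \geq P[1]$ there is a perfect complex $L \in D(\Lambda)$ such that $L \otimes^{\mathbb L}_{\Lambda} \overline\Lambda \cong P$ in $D(\overline\Lambda)$. In particular, every presilting complex of $\overline\Lambda$ has such a lift $L$. -/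

import Mathlib

open CategoryTheory
open scoped TensorProduct MulOpposite

universe w w' u

noncomputable section

namespace SiltingLift

/-! ### Right modules and extension of scalars along a ring homomorphism -/

/-- The category of right modules over a (not necessarily commutative) ring `A`. -/
abbrev RightMod (A : Type u) [Ring A] : Type (u + 1) := ModuleCat.{u} Aᵐᵒᵖ

section ExtendScalars

variable {A B : Type u} [Ring A] [Ring B] (f : A →+* B)

/-- The relations `(f a * b) ⊗ m = b ⊗ (m · a)` in `B ⊗[ℤ] M`, for a right `A`-module `M`.
An element `b ⊗ m` here stands for `m ⊗ b` in the usual notation `M ⊗_A B`;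
`B` acts from the right through the factor `B`. -/
def tensorRelations (M : Type u) [AddCommGroup M] [Module Aᵐᵒᵖ M] :
    Submodule Bᵐᵒᵖ (B ⊗[ℤ] M) :=
  Submodule.span Bᵐᵒᵖ
    {x | ∃ (a : A) (b : B) (m : M),
      x = (f a * b) ⊗ₜ[ℤ] m - b ⊗ₜ[ℤ] (MulOpposite.op a • m)}

/-- The right `B`-module `M ⊗_A B` for a right `A`-module `M`, where `A` acts on `B` from the
left along `f`. -/
abbrev RightTensor (M : Type u) [AddCommGroup M] [Module Aᵐᵒᵖ M] : Type u :=
  (B ⊗[ℤ] M) ⧸ tensorRelations f M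

/-- The map `B ⊗[ℤ] M → B ⊗[ℤ] N`, `b ⊗ m ↦ b ⊗ g m`. -/
def preTensorMap (B : Type u) [Ring B] {M N : Type u} [AddCommGroup M] [Module Aᵐᵒᵖ M]
    [AddCommGroup N] [Module Aᵐᵒᵖ N] (g : M →ₗ[Aᵐᵒᵖ] N) :
    (B ⊗[ℤ] M) →ₗ[Bᵐᵒᵖ] (B ⊗[ℤ] N) where
  toFun := TensorProduct.map LinearMap.id g.toAddMonoidHom.toIntLinearMap
  map_add' := map_add _
  map_smul' c x := by
    induction x using TensorProduct.induction_on with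
    | zero => simp
    | tmul b m => simp [TensorProduct.smul_tmul']
    | add x y hx hy => simp only [smul_add, map_add, hx, hy]

@[simp]
theorem preTensorMap_tmul {M N : Type u} [AddCommGroup M] [Module Aᵐᵒᵖ M]
    [AddCommGroup N] [Module Aᵐᵒᵖ N] (g : M →ₗ[Aᵐᵒᵖ] N) (b : B) (m : M) :
    preTensorMap B g (b ⊗ₜ[ℤ] m) = b ⊗ₜ[ℤ] g m := rfl

theorem tensorRelations_le {M N : Type u} [AddCommGroup M] [Module Aᵐᵒᵖ M]
    [AddCommGroup N] [Module Aᵐᵒᵖ N] (g : M →ₗ[Aᵐᵒᵖ] N) :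
    tensorRelations f M ≤ (tensorRelations f N).comap (preTensorMap B g) := by
  refine Submodule.span_le.2 ?_
  rintro _ ⟨a, b, m, rfl⟩
  refine Submodule.subset_span ⟨a, b, g m, ?_⟩
  simp

/-- The map `g ⊗_A B` for a morphism `g` of right `A`-modules. -/
def rightTensorMap {M N : Type u} [AddCommGroup M] [Module Aᵐᵒᵖ M]
    [AddCommGroup N] [Module Aᵐᵒᵖ N] (g : M →ₗ[Aᵐᵒᵖ] N) :
    RightTensor f M →ₗ[Bᵐᵒᵖ] RightTensor f N :=
  Submodule.mapQ _ _ (preTensorMap B g) (tensorRelations_le f g)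

theorem rightTensor_hom_ext {M X : Type u} [AddCommGroup M] [Module Aᵐᵒᵖ M]
    [AddCommGroup X] [Module Bᵐᵒᵖ X] {φ ψ : RightTensor f M →ₗ[Bᵐᵒᵖ] X}
    (h : ∀ (b : B) (m : M), φ (Submodule.Quotient.mk (b ⊗ₜ[ℤ] m)) =
      ψ (Submodule.Quotient.mk (b ⊗ₜ[ℤ] m))) : φ = ψ := by
  refine LinearMap.ext fun x => ?_
  obtain ⟨x, rfl⟩ := Submodule.Quotient.mk_surjective _ x
  induction x using TensorProduct.induction_on with
  | zero => simp
  | tmul b m => exact h b m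
  | add x y hx hy => simp only [Submodule.Quotient.mk_add, map_add, hx, hy]

/-- The functor `- ⊗_A B` from right `A`-modules to right `B`-modules. -/
def extendScalars : RightMod A ⥤ RightMod B where
  obj M := ModuleCat.of Bᵐᵒᵖ (RightTensor f M)
  map g := ModuleCat.ofHom (rightTensorMap f g.hom)
  map_id _ := ModuleCat.hom_ext (rightTensor_hom_ext f fun _ _ => rfl)
  map_comp _ _ := ModuleCat.hom_ext (rightTensor_hom_ext f fun _ _ => rfl)

instance : (extendScalars f).Additive where
  map_add {_ _ g h} := ModuleCat.hom_ext (rightTensor_hom_ext f fun b m =>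
    congrArg (Submodule.mkQ (tensorRelations f _)) (TensorProduct.tmul_add b (g.hom m) (h.hom m)))

end ExtendScalars

/-! ### Perfect complexes, the relation `≥`, presilting complexes -/

section Derived

variable {A : Type u} [Ring A] [HasDerivedCategory.{w} (RightMod A)]

/-- An object of `D(A)` is perfect if it is isomorphic in `D(A)` to a bounded complex of
finitely generated projective right `A`-modules. -/
def IsPerfect (X : DerivedCategory (RightMod A)) : Prop :=
  ∃ K : CochainComplex (RightMod A) ℤ,
    (∃ a b : ℤ, K.IsStrictlyGE a ∧ K.IsStrictlyLE b) ∧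
    (∀ i : ℤ, Module.Finite Aᵐᵒᵖ (K.X i) ∧ Module.Projective Aᵐᵒᵖ (K.X i)) ∧
    Nonempty (DerivedCategory.Q.obj K ≅ X)

/-- The relation `X ≥ Y`: one has `Hom(X, Y[i]) = 0` in `D(A)` for all `i > 0`. -/
def SiltGE (X Y : DerivedCategory (RightMod A)) : Prop :=
  ∀ i : ℤ, 0 < i → ∀ g : X ⟶ Y⟦i⟧, g = 0

/-- A presilting complex: a perfect complex `X` with `X ≥ X`. -/
def IsPresilting (X : DerivedCategory (RightMod A)) : Prop :=
  IsPerfect X ∧ SiltGE X X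

variable {B : Type u} [Ring B] [HasDerivedCategory.{w'} (RightMod B)]

/-- `L ⊗ᴸ_A B ≅ P` in `D(B)`: the derived tensor product is computed by applying
`- ⊗_A B` termwise to a right-bounded complex of projective right `A`-modules which is
isomorphic to `L` in `D(A)`. -/
def IsDerivedTensor (f : A →+* B) (L : DerivedCategory (RightMod A))
    (P : DerivedCategory (RightMod B)) : Prop :=
  ∃ K : CochainComplex (RightMod A) ℤ,
    (∃ b : ℤ, K.IsStrictlyLE b) ∧
    (∀ i : ℤ, Module.Projective Aᵐᵒᵖ (K.X i)) ∧
    Nonempty (DerivedCategory.Q.obj K ≅ L) ∧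
    Nonempty (DerivedCategory.Q.obj
      (((extendScalars f).mapHomologicalComplex (ComplexShape.up ℤ)).obj K) ≅ P)

/-- The derived tensor product is well defined up to isomorphism: it does not depend on the
complex of projective modules used to compute it. -/
theorem IsDerivedTensor.unique {f : A →+* B} {L : DerivedCategory (RightMod A)}
    {P P' : DerivedCategory (RightMod B)} (h : IsDerivedTensor f L P)
    (h' : IsDerivedTensor f L P') : Nonempty (P ≅ P') := by
  obtain ⟨K, ⟨b, hb⟩, hK, ⟨e⟩, ⟨p⟩⟩ := h
  obtain ⟨K', ⟨b', hb'⟩, hK', ⟨e'⟩, ⟨p'⟩⟩ := h'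
  have : ∀ i, Projective (K.X i) := fun i => (IsProjective.iff_projective (K.X i)).1 (hK i)
  have : ∀ i, Projective (K'.X i) := fun i => (IsProjective.iff_projective (K'.X i)).1 (hK' i)
  have k1 := CochainComplex.isKProjective_of_projective K b
  have k2 := CochainComplex.isKProjective_of_projective K' b'
  let q := HomotopyCategory.quotient (RightMod A) (ComplexShape.up ℤ)
  let iso : DerivedCategory.Qh.obj (q.obj K) ≅ DerivedCategory.Qh.obj (q.obj K') := e ≪≫ e'.symm
  have s1 := CochainComplex.IsKProjective.Qh_map_bijective (K := K) (q.obj K')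
  have s2 := CochainComplex.IsKProjective.Qh_map_bijective (K := K') (q.obj K)
  have s3 := CochainComplex.IsKProjective.Qh_map_bijective (K := K) (q.obj K)
  have s4 := CochainComplex.IsKProjective.Qh_map_bijective (K := K') (q.obj K')
  obtain ⟨a, ha⟩ := s1.2 iso.hom
  obtain ⟨c, hc⟩ := s2.2 iso.inv
  let i1 : q.obj K ≅ q.obj K' :=
    ⟨a, c,
      s3.1 (by
        rw [CategoryTheory.Functor.map_comp, CategoryTheory.Functor.map_id, ha, hc]
        exact iso.hom_inv_id),
      s4.1 (by
        rw [CategoryTheory.Functor.map_comp, CategoryTheory.Functor.map_id, ha, hc]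
        exact iso.inv_hom_id)⟩
  let i2 := ((extendScalars f).mapHomotopyCategory (ComplexShape.up ℤ)).mapIso i1
  exact ⟨p.symm ≪≫ DerivedCategory.Qh.mapIso i2 ≪≫ p'⟩

end Derived

/-! ### The quotient algebra and Tor-vanishing -/

section Quotient

variable {R : Type u} [CommRing R] (Λ : Type u) [Ring Λ] [Algebra R Λ]

/-- The ideal `𝔞Λ` of `Λ` generated by the image of an ideal `𝔞` of `R`. -/
abbrev extIdeal (𝔞 : Ideal R) : Ideal Λ := 𝔞.map (algebraMap R Λ)

instance extIdeal_isTwoSided (𝔞 : Ideal R) : (extIdeal Λ 𝔞).IsTwoSided where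
  mul_mem_of_left {x} y hx := by
    refine Submodule.span_induction (p := fun x _ => x * y ∈ extIdeal Λ 𝔞) ?_ ?_ ?_ ?_ hx
    · rintro _ ⟨r, hr, rfl⟩
      rw [Algebra.commutes]
      exact Ideal.mul_mem_left _ _ (Ideal.mem_map_of_mem _ hr)
    · simp
    · intro x z _ _ hx hz
      rw [add_mul]
      exact Ideal.add_mem _ hx hz
    · intro c x _ hx
      rw [smul_eq_mul, mul_assoc]
      exact Ideal.mul_mem_left _ _ hx

/-- `Tor_i^R(M, N) = 0` for all `i > 0`. -/
def TorPosVanishes (R : Type u) [CommRing R] (M N : Type u) [AddCommGroup M] [Module R M]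
    [AddCommGroup N] [Module R N] : Prop :=
  ∀ i : ℕ, 0 < i →
    Limits.IsZero (((Tor (ModuleCat.{u} R) i).obj (ModuleCat.of R M)).obj (ModuleCat.of R N))

end Quotient

end SiltingLift

end

noncomputable section

namespace SiltingLift

/-! ### Vanishing of Tor through dimension shifting -/

section TorVan

variable {R : Type u} [CommRing R]

/-! This is obstruction theory for deforming a differential. Represent $P$ by a bounded complex of
finitely generated projectives whose terms are all retracts of one free module $\overline\Lambda^n$.
The complex is then encoded by idempotent matrices $e_i$ and matrices $d_i$ over $\overline\Lambda$.
The idempotents lift to $\Lambda$ by Newton iteration (`exists_isIdempotentElem`), and the $d_i$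
lift to a degree-one family $D$ with $D^2 \equiv 0$ modulo $\mathfrak a$. It remains to correct $D$
so that $D^2 = 0$.

Let $E$ be the graded endomorphism module of the lifted projectives. If $D^2 \in \mathfrak a^n E$,
then $D \cdot D^2 = D^2 \cdot D$ makes $D^2$ a degree-two cocycle of $E \otimes_R \mathfrak
a^n/\mathfrak a^{n+1}$. If it bounds $y$, then $D - y$ squares to zero modulo $\mathfrak a^{n+1}$
(`exists_better_differential`). Completeness of finite $R$-modules in the $\mathfrak a$-adic
topology gives the limit (`exists_differential`).

The obstruction vanishes because $P \geq P[1]$ says $H^k(E/\mathfrak a E) = 0$ for $k \geq 2$, and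
this passes to $E \otimes_R N$ for every finite $R/\mathfrak a$-module $N$ with
$\operatorname{Tor}^R_{>0}(\Lambda, N) = 0$ (`exact_tensor_of_exact_mod`): cover $N$ by a free
$R/\mathfrak a$-module and descend from high degrees, where $E$ is zero. The module $\mathfrak
a^n/\mathfrak a^{n+1}$ qualifies as the kernel of $R/\mathfrak a^{n+1} \to R/\mathfrak a^n$. Since
the components of $E$ are summands of powers of $\Lambda$, only Tor against $\Lambda$ matters. -/

theorem exists_pullback {X Y N : Type u} [AddCommGroup X] [Module R X] [AddCommGroup Y]
    [Module R Y] [AddCommGroup N] [Module R N] (g : X →ₗ[R] N) (h : Y →ₗ[R] N)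
    (hg : Function.Surjective g) (hh : Function.Surjective h) :
    ∃ (Z : Submodule R (X × Y)) (i : LinearMap.ker g →ₗ[R] Z) (p : Z →ₗ[R] Y)
      (j : LinearMap.ker h →ₗ[R] Z) (q : Z →ₗ[R] X),
      Function.Injective i ∧ Function.Exact i p ∧ Function.Surjective p ∧
      Function.Injective j ∧ Function.Exact j q ∧ Function.Surjective q ∧
      q ∘ₗ i = (LinearMap.ker g).subtype ∧ p ∘ₗ j = (LinearMap.ker h).subtype ∧
      p ∘ₗ i = 0 ∧ q ∘ₗ j = 0 := by
  let Z : Submodule R (X × Y) :=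
    LinearMap.ker (g ∘ₗ LinearMap.fst R X Y - h ∘ₗ LinearMap.snd R X Y)
  have hZ : ∀ z : X × Y, z ∈ Z ↔ g z.1 = h z.2 := fun z => by
    simp [Z, LinearMap.mem_ker, sub_eq_zero]
  let i : LinearMap.ker g →ₗ[R] Z :=
    (LinearMap.inl R X Y ∘ₗ (LinearMap.ker g).subtype).codRestrict Z fun k => by
      simp [hZ]
  let j : LinearMap.ker h →ₗ[R] Z :=
    (LinearMap.inr R X Y ∘ₗ (LinearMap.ker h).subtype).codRestrict Z fun k => by
      simp [hZ]
  refine ⟨Z, i, LinearMap.snd R X Y ∘ₗ Z.subtype, j, LinearMap.fst R X Y ∘ₗ Z.subtype,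
    ?_, ?_, ?_, ?_, ?_, ?_, rfl, rfl, rfl, rfl⟩
  · intro a b hab
    exact Subtype.ext (congrArg (fun z : Z => z.1.1) hab)
  · rintro ⟨⟨x, y⟩, hz⟩
    rw [hZ] at hz
    constructor
    · intro hy
      change y = 0 at hy
      subst hy
      exact ⟨⟨x, by simpa using hz⟩, rfl⟩
    · rintro ⟨a, ha⟩
      exact (congrArg (fun z : Z => z.1.2) ha).symm
  · intro y
    obtain ⟨x, hx⟩ := hg (h y)
    exact ⟨⟨(x, y), (hZ _).2 hx⟩, rfl⟩
  · intro a b hab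
    exact Subtype.ext (congrArg (fun z : Z => z.1.2) hab)
  · rintro ⟨⟨x, y⟩, hz⟩
    rw [hZ] at hz
    constructor
    · intro hx
      change x = 0 at hx
      subst hx
      exact ⟨⟨y, by simpa using hz.symm⟩, rfl⟩
    · rintro ⟨a, ha⟩
      exact (congrArg (fun z : Z => z.1.1) ha).symm
  · intro x
    obtain ⟨y, hy⟩ := hh (g x)
    exact ⟨⟨(x, y), (hZ _).2 hy.symm⟩, rfl⟩

theorem exists_ker_comp {A B C F : Type u} [AddCommGroup A] [Module R A] [AddCommGroup B]
    [Module R B] [AddCommGroup C] [Module R C] [AddCommGroup F] [Module R F]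
    {f : A →ₗ[R] B} {g : B →ₗ[R] C} (hf : Function.Injective f) (hfg : Function.Exact f g)
    (h : F →ₗ[R] B) (hh : Function.Surjective h) :
    ∃ (i : LinearMap.ker h →ₗ[R] LinearMap.ker (g ∘ₗ h))
      (p : LinearMap.ker (g ∘ₗ h) →ₗ[R] A),
      Function.Injective i ∧ Function.Exact i p ∧ Function.Surjective p ∧
      (LinearMap.ker (g ∘ₗ h)).subtype ∘ₗ i = (LinearMap.ker h).subtype := by
  have hle : LinearMap.ker h ≤ LinearMap.ker (g ∘ₗ h) := LinearMap.ker_le_ker_comp h g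
  let e := LinearEquiv.ofInjective f hf
  let q : LinearMap.ker (g ∘ₗ h) →ₗ[R] LinearMap.range f :=
    (h ∘ₗ (LinearMap.ker (g ∘ₗ h)).subtype).codRestrict _ fun k => (hfg _).1 k.2
  have key : ∀ k, f (e.symm (q k)) = h k := fun k =>
    congrArg Subtype.val (e.apply_symm_apply (q k))
  refine ⟨Submodule.inclusion hle, e.symm.toLinearMap ∘ₗ q, Submodule.inclusion_injective hle,
    ?_, ?_, rfl⟩
  · intro k
    constructor
    · intro hk
      have : h k = 0 := by rw [← key]; exact (congrArg f hk).trans (map_zero f)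
      exact ⟨⟨k, this⟩, rfl⟩
    · rintro ⟨k, rfl⟩
      apply hf
      rw [map_zero]
      exact (key _).trans k.2
  · intro a
    obtain ⟨x, hx⟩ := hh (f a)
    refine ⟨⟨x, ?_⟩, hf ((key _).trans hx)⟩
    change g (h x) = 0
    rw [hx]
    exact (hfg _).2 ⟨a, rfl⟩

variable (R) in
theorem exists_projective_cover (B : Type u) [AddCommGroup B] [Module R B] :
    ∃ (F : Type u) (_ : AddCommGroup F) (_ : Module R F) (_ : Module.Projective R F)
      (h : F →ₗ[R] B), Function.Surjective h :=
  ⟨B →₀ R, inferInstance, inferInstance, inferInstance, Finsupp.linearCombination R id,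
    Finsupp.linearCombination_id_surjective R B⟩

variable (R) (M : Type u) [AddCommGroup M] [Module R M]

/-- The vanishing of `Tor_1^R(M, N)`: short exact sequences ending in `N` stay exact after
tensoring with `M`. -/
def TorInj (N : Type u) [AddCommGroup N] [Module R N] : Prop :=
  ∀ (X : Type u) [AddCommGroup X] [Module R X] (g : X →ₗ[R] N), Function.Surjective g →
    Function.Injective ((LinearMap.ker g).subtype.lTensor M)

/-- The vanishing of `Tor_i^R(M, N)` for `0 < i ≤ k`. -/
def TorVan : ℕ → ∀ (N : Type u) [AddCommGroup N] [Module R N], Prop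
  | 0, _, _, _ => True
  | k + 1, N, _, _ => TorInj R M N ∧ ∀ (F : Type u) [AddCommGroup F] [Module R F]
      [Module.Projective R F] (g : F →ₗ[R] N), Function.Surjective g →
      TorVan k (LinearMap.ker g)

variable {R M} {A B C : Type u} [AddCommGroup A] [Module R A] [AddCommGroup B]
    [Module R B] [AddCommGroup C] [Module R C]

theorem TorInj.lTensor_injective (hC : TorInj R M C) {f : A →ₗ[R] B} {g : B →ₗ[R] C}
    (hf : Function.Injective f) (hfg : Function.Exact f g) (hg : Function.Surjective g) :
    Function.Injective (f.lTensor M) := by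
  have hr : LinearMap.range f = LinearMap.ker g := (LinearMap.exact_iff.1 hfg).symm
  let e := LinearEquiv.ofInjective f hf ≪≫ₗ LinearEquiv.ofEq _ _ hr
  have : f = (LinearMap.ker g).subtype ∘ₗ e.toLinearMap := rfl
  rw [this, LinearMap.lTensor_comp]
  exact (hC B g hg).comp (e.lTensor M).injective

/-- A chase in the pullback of $X$ and $B$ over $C$: an element killed in $M \otimes X$ comes from
$M \otimes A$ and dies in $M \otimes B$. Only injectivity of $M \otimes f$ enters, not that of $f$.
-/
theorem TorInj.of_exact {f : A →ₗ[R] B} {g : B →ₗ[R] C} (hfg : Function.Exact f g)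
    (hg : Function.Surjective g) (hf : Function.Injective (f.lTensor M)) (hB : TorInj R M B) :
    TorInj R M C := by
  intro X _ _ h hh
  obtain ⟨Z, i, p, j, q, hi, hip, hp, hj, hjq, hq, hqi, hpj, hpi, -⟩ :=
    exists_pullback h g hh hg
  rw [injective_iff_map_eq_zero]
  intro t ht
  apply hB.lTensor_injective hi hip hp
  rw [map_zero]
  have h1 : q.lTensor M (i.lTensor M t) = 0 := by
    rw [← LinearMap.lTensor_comp_apply, hqi, ht]
  obtain ⟨s, hs⟩ := (lTensor_exact M hjq hq _).1 h1
  have hfs : Function.Surjective (f.codRestrict (LinearMap.ker g) fun a => (hfg _).2 ⟨a, rfl⟩) := by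
    rintro ⟨b, hb⟩
    obtain ⟨a, rfl⟩ := (hfg b).1 hb
    exact ⟨a, rfl⟩
  obtain ⟨r, rfl⟩ := LinearMap.lTensor_surjective M hfs s
  have h2 : f.lTensor M r = 0 := by
    have : f = p ∘ₗ j ∘ₗ f.codRestrict (LinearMap.ker g) fun a => (hfg _).2 ⟨a, rfl⟩ := by
      rw [← LinearMap.comp_assoc, hpj]; rfl
    rw [this, LinearMap.lTensor_comp_apply, LinearMap.lTensor_comp_apply, hs,
      ← LinearMap.lTensor_comp_apply, hpi, LinearMap.lTensor_zero, LinearMap.zero_apply]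
  rw [← hs, hf (h2.trans (map_zero _).symm), map_zero, map_zero]

theorem TorInj.of_projective [Module.Projective R C] : TorInj R M C := by
  intro X _ _ g hg
  obtain ⟨s, hs⟩ := Module.projective_lifting_property g LinearMap.id hg
  let r : X →ₗ[R] LinearMap.ker g := (LinearMap.id - s ∘ₗ g).codRestrict _ fun x => by
    have := LinearMap.congr_fun hs (g x)
    simp only [LinearMap.comp_apply, LinearMap.id_apply] at this
    simp [this]
  have hr : r ∘ₗ (LinearMap.ker g).subtype = LinearMap.id := by
    ext k
    simp [r]
  refine Function.LeftInverse.injective (g := r.lTensor M) fun t => ?_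
  rw [← LinearMap.lTensor_comp_apply, hr, LinearMap.lTensor_id_apply]

theorem TorInj.extension {f : A →ₗ[R] B} {g : B →ₗ[R] C} (hf : Function.Injective f)
    (hfg : Function.Exact f g) (hg : Function.Surjective g) (hA : TorInj R M A)
    (hC : TorInj R M C) : TorInj R M B := by
  intro X _ _ h hh
  obtain ⟨i, p, hi, hip, hp, hs⟩ := exists_ker_comp hf hfg h hh
  rw [← hs, LinearMap.lTensor_comp]
  exact (hC _ (g ∘ₗ h) (hg.comp hh)).comp (hA.lTensor_injective hi hip hp)

theorem TorInj.of_equiv (e : A ≃ₗ[R] B) (hA : TorInj R M A) : TorInj R M B := by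
  intro X _ _ g hg
  have := hA X (e.symm.toLinearMap ∘ₗ g) (e.symm.surjective.comp hg)
  rwa [LinearEquiv.ker_comp] at this

theorem TorVan.of_equiv {k : ℕ} (e : A ≃ₗ[R] B) (hA : TorVan R M k A) : TorVan R M k B := by
  cases k with
  | zero => trivial
  | succ k =>
    refine ⟨hA.1.of_equiv e, fun F _ _ _ g hg => ?_⟩
    have := hA.2 F (e.symm.toLinearMap ∘ₗ g) (e.symm.surjective.comp hg)
    rwa [LinearEquiv.ker_comp] at this

theorem TorVan.of_projective (k : ℕ) [Module.Projective R C] : TorVan R M k C := by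
  induction k generalizing C with
  | zero => trivial
  | succ k ih =>
    refine ⟨TorInj.of_projective, fun F _ _ _ g hg => ?_⟩
    obtain ⟨s, hs⟩ := Module.projective_lifting_property g LinearMap.id hg
    let r : F →ₗ[R] LinearMap.ker g := (LinearMap.id - s ∘ₗ g).codRestrict _ fun x => by
      have := LinearMap.congr_fun hs (g x)
      simp only [LinearMap.comp_apply, LinearMap.id_apply] at this
      simp [this]
    have hr : r ∘ₗ (LinearMap.ker g).subtype = LinearMap.id := by
      ext k
      simp [r]
    have := Module.Projective.of_split _ _ hr
    exact ih

/-- The two closure properties need a joint induction: the syzygy of an extension is handled by the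
kernel statement one level down, and the kernel statement uses extensions one level down. It
replaces the long exact Tor sequence. -/
theorem TorVan.extension_and_kernel (k : ℕ) :
    (∀ {A B C : Type u} [AddCommGroup A] [Module R A] [AddCommGroup B] [Module R B]
      [AddCommGroup C] [Module R C] {f : A →ₗ[R] B} {g : B →ₗ[R] C}, Function.Injective f →
      Function.Exact f g → Function.Surjective g → TorVan R M k A → TorVan R M k C →
      TorVan R M k B) ∧
    (∀ {A B C : Type u} [AddCommGroup A] [Module R A] [AddCommGroup B] [Module R B]
      [AddCommGroup C] [Module R C] {f : A →ₗ[R] B} {g : B →ₗ[R] C}, Function.Injective f →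
      Function.Exact f g → Function.Surjective g → TorVan R M k B → TorVan R M (k + 1) C →
      TorVan R M k A) := by
  induction k with
  | zero => exact ⟨fun _ _ _ _ _ => trivial, fun _ _ _ _ _ => trivial⟩
  | succ k ih =>
    obtain ⟨ihe, ihk⟩ := ih
    constructor
    · intro A B C _ _ _ _ _ _ f g hf hfg hg hA hC
      refine ⟨TorInj.extension hf hfg hg hA.1 hC.1, fun F _ _ _ h hh => ?_⟩
      obtain ⟨i, p, hi, hip, hp, -⟩ := exists_ker_comp hf hfg h hh
      exact ihk hi hip hp (hC.2 F (g ∘ₗ h) (hg.comp hh)) hA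
    · intro A B C _ _ _ _ _ _ f g hf hfg hg hB hC
      obtain ⟨F₀, _, _, _, h, hh⟩ := exists_projective_cover R B
      obtain ⟨i, p, hi, hip, hp, hs⟩ := exists_ker_comp hf hfg h hh
      have hK : TorVan R M (k + 1) (LinearMap.ker (g ∘ₗ h)) := hC.2 _ (g ∘ₗ h) (hg.comp hh)
      constructor
      · refine TorInj.of_exact hip hp ?_ hK.1
        have := hB.1 _ h hh
        rw [← hs, LinearMap.lTensor_comp] at this
        exact Function.Injective.of_comp this
      · intro F _ _ _ h' hh'
        obtain ⟨Z, i', p', j', q', hi', hip', hp', hj', hjq', hq', -⟩ :=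
          exists_pullback p h' hp hh'
        have hkp : TorVan R M k (LinearMap.ker p) := by
          refine TorVan.of_equiv ?_ (hB.2 _ h hh)
          exact LinearEquiv.ofInjective i hi ≪≫ₗ
            LinearEquiv.ofEq _ _ (LinearMap.exact_iff.1 hip).symm
        exact ihk hj' hjq' hq' (ihe hi' hip' hp' hkp (TorVan.of_projective k)) hK

theorem TorVan.extension {k : ℕ} {f : A →ₗ[R] B} {g : B →ₗ[R] C} (hf : Function.Injective f)
    (hfg : Function.Exact f g) (hg : Function.Surjective g) (hA : TorVan R M k A)
    (hC : TorVan R M k C) : TorVan R M k B :=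
  (TorVan.extension_and_kernel k).1 hf hfg hg hA hC

theorem TorVan.kernel {k : ℕ} {f : A →ₗ[R] B} {g : B →ₗ[R] C} (hf : Function.Injective f)
    (hfg : Function.Exact f g) (hg : Function.Surjective g) (hB : TorVan R M k B)
    (hC : TorVan R M (k + 1) C) : TorVan R M k A :=
  (TorVan.extension_and_kernel k).2 hf hfg hg hB hC

/-- Schanuel's argument: `TorVan` quantifies over all projective covers, but one cover decides it,
since two syzygies are compared through the pullback of the covers. -/
theorem TorVan.of_cover {k : ℕ} [Module.Projective R B] {g : B →ₗ[R] C}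
    (hg : Function.Surjective g) (hf : Function.Injective ((LinearMap.ker g).subtype.lTensor M))
    (hA : TorVan R M k (LinearMap.ker g)) : TorVan R M (k + 1) C := by
  refine ⟨TorInj.of_exact (LinearMap.exact_subtype_ker_map g) hg hf TorInj.of_projective, ?_⟩
  intro F _ _ _ h hh
  obtain ⟨Z, i, p, j, q, hi, hip, hp, hj, hjq, hq, -⟩ := exists_pullback g h hg hh
  exact TorVan.kernel hj hjq hq (TorVan.extension hi hip hp hA (TorVan.of_projective k))
    (TorVan.of_projective (k + 1))

end TorVan

/-! ### From Tor as a derived functor to dimension shifting -/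

section TorBridge

variable {R : Type u} [CommRing R] (M : Type u) [AddCommGroup M] [Module R M]

/-- An element of $M \otimes \ker d_0$ lifts to $M \otimes X_1$. If it dies in $M \otimes X_0$,
exactness puts the lift in the image of $M \otimes X_2$, which maps to zero in $M \otimes \ker d_0$.
-/
theorem lTensor_ker_subtype_injective {X₂ X₁ X₀ N : Type u} [AddCommGroup X₂] [Module R X₂]
    [AddCommGroup X₁] [Module R X₁] [AddCommGroup X₀] [Module R X₀] [AddCommGroup N] [Module R N]
    {d₂ : X₂ →ₗ[R] X₁} {d₁ : X₁ →ₗ[R] X₀} {d₀ : X₀ →ₗ[R] N} (h : Function.Exact d₁ d₀)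
    (h' : d₁ ∘ₗ d₂ = 0) (ht : Function.Exact (d₂.lTensor M) (d₁.lTensor M)) :
    Function.Injective ((LinearMap.ker d₀).subtype.lTensor M) := by
  let q : X₁ →ₗ[R] LinearMap.ker d₀ := d₁.codRestrict _ fun a => (h _).2 ⟨a, rfl⟩
  have hq : Function.Surjective q := by
    rintro ⟨b, hb⟩
    obtain ⟨a, rfl⟩ := (h b).1 hb
    exact ⟨a, rfl⟩
  have hq2 : q ∘ₗ d₂ = 0 := by
    ext x
    exact LinearMap.congr_fun h' x
  rw [injective_iff_map_eq_zero]
  intro t h0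
  obtain ⟨s, rfl⟩ := LinearMap.lTensor_surjective M hq t
  rw [← LinearMap.lTensor_comp_apply] at h0
  obtain ⟨r, rfl⟩ := (ht s).1 h0
  rw [← LinearMap.lTensor_comp_apply, hq2, LinearMap.lTensor_zero, LinearMap.zero_apply]

variable {M}

theorem TorVan.of_resolution {N : Type u} [AddCommGroup N] [Module R N] (X : ℕ → Type u)
    [∀ n, AddCommGroup (X n)] [∀ n, Module R (X n)] [∀ n, Module.Projective R (X n)]
    (d : ∀ n, X (n + 1) →ₗ[R] X n) (ε : X 0 →ₗ[R] N) (hε : Function.Surjective ε)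
    (h0 : Function.Exact (d 0) ε) (hd : ∀ n, Function.Exact (d (n + 1)) (d n))
    (ht : ∀ n, Function.Exact ((d (n + 1)).lTensor M) ((d n).lTensor M)) (k : ℕ) :
    TorVan R M k N := by
  have hdd : ∀ n, d n ∘ₗ d (n + 1) = 0 := fun n => (hd n).linearMap_comp_eq_zero
  have key : ∀ k n, TorVan R M k (LinearMap.range (d n)) := by
    intro k
    induction k with
    | zero => exact fun _ => trivial
    | succ k ih =>
      intro n
      refine TorVan.of_cover (g := (d n).rangeRestrict) (d n).surjective_rangeRestrict ?_ ?_
      · refine lTensor_ker_subtype_injective M ?_ (hdd (n + 1)) (ht (n + 1))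
        rw [LinearMap.exact_iff, LinearMap.ker_rangeRestrict]
        exact LinearMap.exact_iff.1 (hd n)
      · refine TorVan.of_equiv (LinearEquiv.ofEq _ _ ?_) (ih (n + 1))
        rw [LinearMap.ker_rangeRestrict]
        exact (LinearMap.exact_iff.1 (hd n)).symm
  cases k with
  | zero => trivial
  | succ k =>
    refine TorVan.of_cover hε (lTensor_ker_subtype_injective M h0 (hdd 0) (ht 0)) ?_
    exact TorVan.of_equiv (LinearEquiv.ofEq _ _ (LinearMap.exact_iff.1 h0).symm) (key k 0)

theorem TorVan.of_torPosVanishes {N : Type u} [AddCommGroup N] [Module R N]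
    (h : TorPosVanishes R M N) (k : ℕ) : TorVan R M k N := by
  let P := projectiveResolution (ModuleCat.of R N)
  let F := (MonoidalCategory.tensoringLeft (ModuleCat.{u} R)).obj (ModuleCat.of R M)
  have hproj : ∀ n, Module.Projective R (P.complex.X n) := fun n =>
    (IsProjective.iff_projective (P.complex.X n)).2 (P.projective n)
  refine TorVan.of_resolution (fun n => P.complex.X n) (fun n => (P.complex.d (n + 1) n).hom)
    (P.π.f 0).hom ?_ ?_ ?_ ?_ k
  · exact (ModuleCat.epi_iff_surjective _).1 inferInstance
  · exact (ShortComplex.ShortExact.moduleCat_exact_iff_function_exact _).1 P.exact₀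
  · intro n
    exact (ShortComplex.ShortExact.moduleCat_exact_iff_function_exact _).1 (P.exact_succ n)
  · intro n
    have h1 := (h (n + 1) n.succ_pos).of_iso (P.isoLeftDerivedObj F (n + 1)).symm
    have h2 : ((F.mapHomologicalComplex _).obj P.complex).ExactAt (n + 1) := by
      rw [HomologicalComplex.exactAt_iff_isZero_homology]
      exact h1
    have h3 := (HomologicalComplex.exactAt_iff' _ (n + 2) (n + 1) n (by simp) (by simp)).1 h2
    exact (ShortComplex.ShortExact.moduleCat_exact_iff_function_exact _).1 h3

end TorBridge

/-! ### Base change of cochain complexes which are exact modulo an ideal -/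

section BaseChange

variable {R : Type u} [CommRing R]

/-- `E` is a direct summand of a finite power of `M`. -/
def IsPowerSummand (R : Type u) [CommRing R] (M E : Type u) [AddCommGroup M] [Module R M]
    [AddCommGroup E] [Module R E] : Prop :=
  ∃ (ι : Type) (_ : Fintype ι) (i : ι → E →ₗ[R] M) (r : ι → M →ₗ[R] E),
    ∑ j, r j ∘ₗ i j = LinearMap.id

variable {M E : Type u} [AddCommGroup M] [Module R M] [AddCommGroup E] [Module R E]

theorem IsPowerSummand.lTensor_injective (hE : IsPowerSummand R M E) {K X : Type u}
    [AddCommGroup K] [Module R K] [AddCommGroup X] [Module R X] {g : K →ₗ[R] X}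
    (hg : Function.Injective (g.lTensor M)) : Function.Injective (g.lTensor E) := by
  obtain ⟨ι, _, i, r, hir⟩ := hE
  rw [injective_iff_map_eq_zero]
  intro t ht
  have h1 : ∀ j, (i j).rTensor K t = 0 := fun j => by
    apply hg
    rw [map_zero, ← LinearMap.comp_apply, LinearMap.lTensor_comp_rTensor,
      ← LinearMap.rTensor_comp_lTensor, LinearMap.comp_apply, ht, map_zero]
  have h2 : ∑ j, (r j).rTensor K ((i j).rTensor K t) = t := by
    have := congrArg (fun f => LinearMap.rTensor K f t) hir
    rw [← LinearMap.coe_rTensorHom, map_sum, LinearMap.sum_apply] at this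
    simpa only [LinearMap.coe_rTensorHom, LinearMap.rTensor_comp_apply,
      LinearMap.rTensor_id_apply] using this
  rw [← h2]
  simp [h1]

theorem tmul_eq_zero_of_mem_smul_top {I : Ideal R} {N : Type u} [AddCommGroup N] [Module R N]
    {e : E} (he : e ∈ I • (⊤ : Submodule R E)) {x : N} (hx : ∀ a ∈ I, a • x = 0) :
    e ⊗ₜ[R] x = 0 := by
  induction he using Submodule.smul_induction_on' with
  | smul a ha e _ => rw [TensorProduct.smul_tmul, hx a ha, TensorProduct.tmul_zero]
  | add e _ f _ he hf => rw [TensorProduct.add_tmul, he, hf, add_zero]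

theorem tmul_mk_one_eq_zero_iff {I : Ideal R} {e : E} :
    e ⊗ₜ[R] (Ideal.Quotient.mk I 1) = 0 ↔ e ∈ I • (⊤ : Submodule R E) := by
  constructor
  · intro h
    have := congrArg (TensorProduct.tensorQuotEquivQuotSMul E I) h
    rw [map_zero] at this
    rw [← Submodule.Quotient.mk_eq_zero, ← this]
    exact ((TensorProduct.tensorQuotEquivQuotSMul_tmul_mk I e 1).trans (by rw [one_smul])).symm
  · intro h
    refine tmul_eq_zero_of_mem_smul_top h fun a ha => ?_
    exact Ideal.Quotient.eq_zero_iff_mem.2 (I.mul_mem_right _ ha)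

theorem exists_tmul_mk_one (I : Ideal R) (x : E ⊗[R] (R ⧸ I)) :
    ∃ e : E, x = e ⊗ₜ[R] (Ideal.Quotient.mk I 1) := by
  induction x using TensorProduct.induction_on with
  | zero => exact ⟨0, by simp⟩
  | tmul e q =>
    obtain ⟨a, rfl⟩ := Ideal.Quotient.mk_surjective q
    refine ⟨a • e, ?_⟩
    rw [TensorProduct.smul_tmul]
    exact congrArg _ (congrArg (Ideal.Quotient.mk I) (mul_one a).symm)
  | add x y hx hy =>
    obtain ⟨e, rfl⟩ := hx
    obtain ⟨f, rfl⟩ := hy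
    exact ⟨e + f, (TensorProduct.add_tmul _ _ _).symm⟩

theorem TorVan.pi {k : ℕ} {Q : Type u} [AddCommGroup Q] [Module R Q] (hQ : TorVan R M k Q)
    (r : ℕ) : TorVan R M k (Fin r → Q) := by
  induction r with
  | zero =>
    have : Module.Projective R (Fin 0 → Q) := inferInstance
    exact TorVan.of_projective k
  | succ r ih =>
    refine TorVan.extension (f := LinearMap.single R (fun _ => Q) (0 : Fin (r + 1)))
      (g := LinearMap.funLeft R Q Fin.succ) ?_ ?_ ?_ hQ ih
    · exact Pi.single_injective (M := fun _ => Q) 0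
    · intro v
      constructor
      · intro hv
        refine ⟨v 0, ?_⟩
        funext j
        refine Fin.cases ?_ (fun j => ?_) j
        · simp
        · simpa using (congrFun hv j).symm
      · rintro ⟨q, rfl⟩
        funext j
        simp [LinearMap.funLeft_apply]
    · exact LinearMap.funLeft_surjective_of_injective R Q _ (Fin.succ_injective r)

theorem exists_finite_cover (I : Ideal R) (N : Type u) [AddCommGroup N] [Module R N]
    [Module.Finite R N] (hN : ∀ a ∈ I, ∀ x : N, a • x = 0) :
    ∃ (r : ℕ) (g : (Fin r → R ⧸ I) →ₗ[R] N), Function.Surjective g := by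
  obtain ⟨r, f, hf⟩ := Module.Finite.exists_fin' R N
  let c : Fin r → (R ⧸ I) →ₗ[R] N := fun j =>
    Submodule.liftQ I (f ∘ₗ LinearMap.single R (fun _ => R) j) fun a ha => by
      have : (LinearMap.single R (fun _ => R) j) a = a • Pi.single j 1 := by
        rw [← Pi.single_smul]; simp
      rw [LinearMap.mem_ker, LinearMap.comp_apply, this, map_smul, hN a ha]
  refine ⟨r, ∑ j, c j ∘ₗ LinearMap.proj j, fun x => ?_⟩
  obtain ⟨v, rfl⟩ := hf x
  refine ⟨fun j => Submodule.Quotient.mk (v j), ?_⟩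
  simp only [LinearMap.sum_apply, LinearMap.comp_apply, LinearMap.proj_apply, c,
    Submodule.liftQ_apply]
  rw [← map_sum]
  congr 1
  exact LinearMap.sum_single_apply (fun _ => R) v

variable (E : ℕ → Type u) [∀ j, AddCommGroup (E j)] [∀ j, Module R (E j)]
  (δ : ∀ j, E j →ₗ[R] E (j + 1)) (𝔞 : Ideal R)

/-- Here `δ` squares to zero only modulo `𝔞`, hence becomes a differential after tensoring with a
module killed by `𝔞`. Exactness for $R/\mathfrak a$ is the hypothesis; general $N$ follows by
dimension shifting, which raises the cohomological degree. -/
theorem exact_tensor_of_exact_mod [IsNoetherianRing R] (hE : ∀ j, IsPowerSummand R M (E j))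
    (hM : ∀ k, TorVan R M k (R ⧸ 𝔞))
    (hδ : ∀ j x, δ (j + 1) (δ j x) ∈ 𝔞 • (⊤ : Submodule R (E (j + 1 + 1))))
    (hex : ∀ j (x : E (j + 1)), δ (j + 1) x ∈ 𝔞 • (⊤ : Submodule R (E (j + 1 + 1))) →
      ∃ y, x - δ j y ∈ 𝔞 • (⊤ : Submodule R (E (j + 1))))
    (m : ℕ) (hm : ∀ j, m ≤ j → Subsingleton (E j)) (j : ℕ) (N : Type u) [AddCommGroup N]
    [Module R N] [Module.Finite R N] (hN : ∀ a ∈ 𝔞, ∀ x : N, a • x = 0)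
    (hT : ∀ k, TorVan R M k N) (x : E (j + 1) ⊗[R] N) (hx : (δ (j + 1)).rTensor N x = 0) :
    ∃ y, x = (δ j).rTensor N y := by
  -- Descending induction on the degree: `c` bounds the distance to the range where `E` vanishes,
  -- and `N` varies along the induction.
  obtain ⟨c, hc⟩ : ∃ c, m ≤ j + c := ⟨m, Nat.le_add_left m j⟩
  induction c generalizing j N with
  | zero =>
    have := hm (j + 1) (by omega)
    exact ⟨0, Subsingleton.elim _ _⟩
  | succ c ih =>
    obtain ⟨r, g, hg⟩ := exists_finite_cover 𝔞 N hN
    have hF : ∀ a ∈ 𝔞, ∀ v : Fin r → R ⧸ 𝔞, a • v = 0 := by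
      intro a ha v
      funext i
      obtain ⟨b, hb⟩ := Ideal.Quotient.mk_surjective (v i)
      rw [Pi.smul_apply, ← hb]
      exact Ideal.Quotient.eq_zero_iff_mem.2 (𝔞.mul_mem_right _ ha)
    have hδδ : ∀ j (t : E j ⊗[R] (Fin r → R ⧸ 𝔞)),
        (δ (j + 1)).rTensor _ ((δ j).rTensor _ t) = 0 := by
      intro j t
      induction t using TensorProduct.induction_on with
      | zero => simp
      | tmul e v =>
        rw [LinearMap.rTensor_tmul, LinearMap.rTensor_tmul]
        exact tmul_eq_zero_of_mem_smul_top (hδ j e) fun a ha => hF a ha v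
      | add s t hs ht => rw [map_add, map_add, hs, ht, add_zero]
    -- For a free $R/\mathfrak a$-module, exactness is checked one coordinate at a time and
    -- reassembled.
    have hFex : ∀ t : E (j + 1) ⊗[R] (Fin r → R ⧸ 𝔞), (δ (j + 1)).rTensor _ t = 0 →
        ∃ y, t = (δ j).rTensor _ y := by
      intro t ht
      have h1 : ∀ i : Fin r, ∃ y, (LinearMap.proj (R := R) (φ := fun _ : Fin r => R ⧸ 𝔞) i).lTensor
          _ t = (δ j).rTensor _ y := by
        intro i
        obtain ⟨e, he⟩ := exists_tmul_mk_one 𝔞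
          ((LinearMap.proj (R := R) (φ := fun _ : Fin r => R ⧸ 𝔞) i).lTensor _ t)
        have h2 : (δ (j + 1) e) ⊗ₜ[R] (Ideal.Quotient.mk 𝔞 1) = 0 := by
          rw [← LinearMap.rTensor_tmul, ← he, ← LinearMap.comp_apply,
            LinearMap.rTensor_comp_lTensor, ← LinearMap.lTensor_comp_rTensor,
            LinearMap.comp_apply, ht, map_zero]
        obtain ⟨y, hy⟩ := hex j e (tmul_mk_one_eq_zero_iff.1 h2)
        refine ⟨y ⊗ₜ Ideal.Quotient.mk 𝔞 1, ?_⟩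
        rw [he, LinearMap.rTensor_tmul, ← sub_eq_zero, ← TensorProduct.sub_tmul,
          tmul_mk_one_eq_zero_iff]
        exact hy
      choose y hy using h1
      refine ⟨∑ i, (LinearMap.single R (fun _ : Fin r => R ⧸ 𝔞) i).lTensor _ (y i), ?_⟩
      have h3 : ∑ i, (LinearMap.single R (fun _ : Fin r => R ⧸ 𝔞) i) ∘ₗ LinearMap.proj i =
          LinearMap.id := by
        refine LinearMap.ext fun v => ?_
        simpa using LinearMap.sum_single_apply (fun _ : Fin r => R ⧸ 𝔞) v
      have h4 : t = ∑ i, (LinearMap.single R (fun _ : Fin r => R ⧸ 𝔞) i).lTensor _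
          ((LinearMap.proj (R := R) (φ := fun _ : Fin r => R ⧸ 𝔞) i).lTensor _ t) := by
        have := congrArg (fun f => LinearMap.lTensor (E (j + 1)) f t) h3
        rw [← LinearMap.coe_lTensorHom, map_sum, LinearMap.sum_apply] at this
        simpa only [LinearMap.coe_lTensorHom, LinearMap.lTensor_comp_apply,
          LinearMap.lTensor_id_apply] using this.symm
      rw [h4, map_sum]
      refine Finset.sum_congr rfl fun i _ => ?_
      rw [hy, ← LinearMap.comp_apply, LinearMap.lTensor_comp_rTensor,
        ← LinearMap.rTensor_comp_lTensor, LinearMap.comp_apply]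
    have hTK : ∀ k, TorVan R M k (LinearMap.ker g) := fun k =>
      TorVan.kernel (Submodule.subtype_injective _) (LinearMap.exact_subtype_ker_map g) hg
        ((hM k).pi r) (hT (k + 1))
    have hinj : ∀ i, Function.Injective ((LinearMap.ker g).subtype.lTensor (E i)) := fun i =>
      (hE i).lTensor_injective ((hT 1).1 _ g hg)
    have hexg : ∀ i, Function.Exact ((LinearMap.ker g).subtype.lTensor (E i)) (g.lTensor (E i)) :=
      fun i => lTensor_exact (E i) (LinearMap.exact_subtype_ker_map g) hg
    -- The connecting map: lift the cocycle to the free module. Its coboundary comes from a cocycle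
    -- `z` over $\ker g$, which bounds some `w` by induction. Subtracting `w` makes the lift a
    -- cocycle, hence a boundary.
    obtain ⟨t, rfl⟩ := LinearMap.lTensor_surjective (E (j + 1)) hg x
    obtain ⟨z, hz⟩ := (hexg (j + 1 + 1) ((δ (j + 1)).rTensor _ t)).1 (by
      rw [← LinearMap.comp_apply, LinearMap.lTensor_comp_rTensor,
        ← LinearMap.rTensor_comp_lTensor, LinearMap.comp_apply, hx])
    have hz0 : (δ (j + 1 + 1)).rTensor _ z = 0 := by
      apply hinj
      rw [map_zero, ← LinearMap.comp_apply, LinearMap.lTensor_comp_rTensor,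
        ← LinearMap.rTensor_comp_lTensor, LinearMap.comp_apply, hz, hδδ]
    obtain ⟨w, rfl⟩ := ih (j + 1) (LinearMap.ker g) (fun a ha v => Subtype.ext (hF a ha v))
      hTK z hz0 (by omega)
    obtain ⟨y, hy⟩ := hFex (t - (LinearMap.ker g).subtype.lTensor _ w) (by
      rw [map_sub, ← hz, sub_eq_zero, ← LinearMap.comp_apply, ← LinearMap.comp_apply,
        LinearMap.lTensor_comp_rTensor, LinearMap.rTensor_comp_lTensor])
    refine ⟨g.lTensor _ y, ?_⟩
    have h5 : g.lTensor (E (j + 1)) ((LinearMap.ker g).subtype.lTensor _ w) = 0 :=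
      (hexg (j + 1)).apply_apply_eq_zero w
    rw [← sub_zero (g.lTensor _ t), ← h5, ← map_sub, hy, ← LinearMap.comp_apply,
      ← LinearMap.comp_apply, LinearMap.lTensor_comp_rTensor, LinearMap.rTensor_comp_lTensor]

end BaseChange

/-! ### Exactness on the graded pieces of the adic filtration -/

section Step

variable {R : Type u} [CommRing R] {M : Type u} [AddCommGroup M] [Module R M]
  (E : ℕ → Type u) [∀ j, AddCommGroup (E j)] [∀ j, Module R (E j)]
  (δ : ∀ j, E j →ₗ[R] E (j + 1)) (𝔞 : Ideal R)

theorem exists_sub_mem_pow_succ [IsNoetherianRing R] (hE : ∀ j, IsPowerSummand R M (E j))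
    (hM : ∀ n, 0 < n → ∀ k, TorVan R M k (R ⧸ 𝔞 ^ n))
    (hδ : ∀ j x, δ (j + 1) (δ j x) ∈ 𝔞 • (⊤ : Submodule R (E (j + 1 + 1))))
    (hex : ∀ j (x : E (j + 1)), δ (j + 1) x ∈ 𝔞 • (⊤ : Submodule R (E (j + 1 + 1))) →
      ∃ y, x - δ j y ∈ 𝔞 • (⊤ : Submodule R (E (j + 1))))
    (m : ℕ) (hm : ∀ j, m ≤ j → Subsingleton (E j)) (j n : ℕ) (hn : 0 < n) (x : E (j + 1))
    (hx : x ∈ 𝔞 ^ n • (⊤ : Submodule R (E (j + 1))))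
    (hδx : δ (j + 1) x ∈ 𝔞 ^ (n + 1) • (⊤ : Submodule R (E (j + 1 + 1)))) :
    ∃ y ∈ 𝔞 ^ n • (⊤ : Submodule R (E j)),
      x - δ j y ∈ 𝔞 ^ (n + 1) • (⊤ : Submodule R (E (j + 1))) := by
  -- The kernel of `g` is $\mathfrak a^n/\mathfrak a^{n+1}$. As $\operatorname{Tor}_1(M, R/\mathfrak
  -- a^n) = 0$, tensoring it with $E_i$ gives exactly $\mathfrak a^n E_i/\mathfrak a^{n+1} E_i$;
  -- `lift` and `descend` pass between the two.
  let g : (R ⧸ 𝔞 ^ (n + 1)) →ₗ[R] R ⧸ 𝔞 ^ n :=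
    Submodule.mapQ (𝔞 ^ (n + 1)) (𝔞 ^ n) LinearMap.id (Ideal.pow_le_pow_right n.le_succ)
  have hg : Function.Surjective g := by
    intro q
    obtain ⟨a, rfl⟩ := Ideal.Quotient.mk_surjective q
    exact ⟨Ideal.Quotient.mk _ a, rfl⟩
  have hker : ∀ a, Ideal.Quotient.mk (𝔞 ^ (n + 1)) a ∈ LinearMap.ker g ↔ a ∈ 𝔞 ^ n := fun a =>
    Ideal.Quotient.eq_zero_iff_mem (I := 𝔞 ^ n)
  have hT : ∀ k, TorVan R M k (LinearMap.ker g) := fun k =>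
    TorVan.kernel (Submodule.subtype_injective _) (LinearMap.exact_subtype_ker_map g) hg
      (hM (n + 1) n.succ_pos k) (hM n hn (k + 1))
  have hinj : ∀ i, Function.Injective ((LinearMap.ker g).subtype.lTensor (E i)) := fun i =>
    (hE i).lTensor_injective ((hM n hn 1).1 _ g hg)
  have hkill : ∀ a ∈ 𝔞, ∀ v : LinearMap.ker g, a • v = 0 := by
    rintro a ha ⟨v, hv⟩
    obtain ⟨b, rfl⟩ := Ideal.Quotient.mk_surjective v
    rw [hker] at hv
    refine Subtype.ext (Ideal.Quotient.eq_zero_iff_mem.2 ?_)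
    rw [pow_succ']
    exact Ideal.mul_mem_mul ha hv
  have lift : ∀ i, ∀ e ∈ 𝔞 ^ n • (⊤ : Submodule R (E i)), ∃ ξ : E i ⊗[R] LinearMap.ker g,
      (LinearMap.ker g).subtype.lTensor (E i) ξ = e ⊗ₜ Ideal.Quotient.mk _ 1 := by
    intro i e he
    induction he using Submodule.smul_induction_on' with
    | smul a ha e _ =>
      refine ⟨e ⊗ₜ ⟨Ideal.Quotient.mk _ a, (hker a).2 ha⟩, ?_⟩
      rw [LinearMap.lTensor_tmul, TensorProduct.smul_tmul]
      exact congrArg _ (congrArg (Ideal.Quotient.mk _) (mul_one a).symm)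
    | add e _ f _ he hf =>
      obtain ⟨ξ, hξ⟩ := he
      obtain ⟨η, hη⟩ := hf
      exact ⟨ξ + η, by rw [map_add, hξ, hη, TensorProduct.add_tmul]⟩
  have descend : ∀ i (ξ : E i ⊗[R] LinearMap.ker g), ∃ e ∈ 𝔞 ^ n • (⊤ : Submodule R (E i)),
      (LinearMap.ker g).subtype.lTensor (E i) ξ = e ⊗ₜ Ideal.Quotient.mk _ 1 := by
    intro i ξ
    induction ξ using TensorProduct.induction_on with
    | zero => exact ⟨0, zero_mem _, by simp⟩
    | tmul e v =>
      obtain ⟨v, hv⟩ := v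
      obtain ⟨a, rfl⟩ := Ideal.Quotient.mk_surjective v
      refine ⟨a • e, Submodule.smul_mem_smul ((hker a).1 hv) trivial, ?_⟩
      rw [LinearMap.lTensor_tmul, TensorProduct.smul_tmul]
      exact congrArg _ (congrArg (Ideal.Quotient.mk _) (mul_one a).symm)
    | add ξ η hξ hη =>
      obtain ⟨e, he, hξ⟩ := hξ
      obtain ⟨f, hf, hη⟩ := hη
      exact ⟨e + f, add_mem he hf, by rw [map_add, hξ, hη, TensorProduct.add_tmul]⟩
  have comm : ∀ i (ξ : E i ⊗[R] LinearMap.ker g),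
      (LinearMap.ker g).subtype.lTensor (E (i + 1)) ((δ i).rTensor _ ξ) =
        (δ i).rTensor _ ((LinearMap.ker g).subtype.lTensor (E i) ξ) := fun i ξ => by
    rw [← LinearMap.comp_apply, ← LinearMap.comp_apply, LinearMap.lTensor_comp_rTensor,
      LinearMap.rTensor_comp_lTensor]
  obtain ⟨ξ, hξ⟩ := lift (j + 1) x hx
  have hM' : ∀ k, TorVan R M k (R ⧸ 𝔞) := fun k =>
    (hM 1 one_pos k).of_equiv (Submodule.quotEquivOfEq _ _ (pow_one 𝔞))
  obtain ⟨η, rfl⟩ := exact_tensor_of_exact_mod E δ 𝔞 hE hM' hδ hex m hm j (LinearMap.ker g)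
    hkill hT ξ (by
      apply hinj
      rw [comm, hξ, LinearMap.rTensor_tmul, map_zero]
      exact tmul_mk_one_eq_zero_iff.2 hδx)
  obtain ⟨y, hy, hη⟩ := descend j η
  refine ⟨y, hy, tmul_mk_one_eq_zero_iff.1 ?_⟩
  rw [TensorProduct.sub_tmul, ← hξ, comm, hη, LinearMap.rTensor_tmul, sub_self]

end Step

/-! ### Completeness of finite modules -/

section Complete

variable {R : Type u} [CommRing R]

theorem map_mem_smul_top {A B : Type*} [AddCommGroup A] [Module R A] [AddCommGroup B] [Module R B]
    {I : Ideal R} (f : A →ₗ[R] B) {x : A} (hx : x ∈ I • (⊤ : Submodule R A)) :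
    f x ∈ I • (⊤ : Submodule R B) :=
  Submodule.smul_top_le_comap_smul_top I f hx

theorem exists_preimage_mem_smul_top {A B : Type*} [AddCommGroup A] [Module R A] [AddCommGroup B]
    [Module R B] {I : Ideal R} {f : A →ₗ[R] B} (hf : Function.Surjective f) {x : B}
    (hx : x ∈ I • (⊤ : Submodule R B)) : ∃ y ∈ I • (⊤ : Submodule R A), f y = x := by
  rw [← LinearMap.range_eq_top.2 hf, ← Submodule.map_top, ← Submodule.map_smul''] at hx
  exact hx

theorem pi_mem_smul_top_iff {ι : Type*} [Finite ι] {A : Type*} [AddCommGroup A] [Module R A]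
    {I : Ideal R} {x : ι → A} :
    x ∈ I • (⊤ : Submodule R (ι → A)) ↔ ∀ i, x i ∈ I • (⊤ : Submodule R A) := by
  classical
  cases nonempty_fintype ι
  refine ⟨fun h i => map_mem_smul_top (LinearMap.proj i) h, fun h => ?_⟩
  rw [← LinearMap.sum_single_apply (fun _ => A) x]
  exact sum_mem fun i _ => map_mem_smul_top (LinearMap.single R (fun _ => A) i) (h i)

theorem smul_top_mono {A : Type*} [AddCommGroup A] [Module R A] {I J : Ideal R} (h : I ≤ J) :
    I • (⊤ : Submodule R A) ≤ J • (⊤ : Submodule R A) :=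
  Submodule.smul_mono_left h

theorem sub_mem_pow_of_succ {A : Type*} [AddCommGroup A] [Module R A] {I : Ideal R} {a : ℕ → A}
    (h : ∀ n, a (n + 1) - a n ∈ I ^ n • (⊤ : Submodule R A)) {m n : ℕ} (hmn : m ≤ n) :
    a n - a m ∈ I ^ m • (⊤ : Submodule R A) := by
  induction n, hmn using Nat.le_induction with
  | base => simp
  | succ n hmn ih =>
    rw [← sub_add_sub_cancel]
    exact add_mem (smul_top_mono (Ideal.pow_le_pow_right hmn) (h n)) ih

variable [IsLocalRing R] {A : Type*} [AddCommGroup A] [Module R A] [Module.Finite R A]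

theorem eq_zero_of_forall_mem_pow [IsNoetherianRing R] {𝔞 : Ideal R} (h𝔞 : 𝔞 ≠ ⊤) {x : A}
    (hx : ∀ n, x ∈ 𝔞 ^ n • (⊤ : Submodule R A)) : x = 0 :=
  (IsHausdorff.of_isLocalRing 𝔞 A h𝔞).haus x fun n => SModEq.zero.2 (hx n)

variable [IsAdicComplete (IsLocalRing.maximalIdeal R) R]

theorem exists_limit_maximalIdeal {a : ℕ → A}
    (ha : ∀ n, a (n + 1) - a n ∈ IsLocalRing.maximalIdeal R ^ n • (⊤ : Submodule R A)) :
    ∃ x, ∀ n, x - a n ∈ IsLocalRing.maximalIdeal R ^ n • (⊤ : Submodule R A) := by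
  obtain ⟨r, f, hf⟩ := Module.Finite.exists_fin' R A
  choose c hc hfc using fun n => exists_preimage_mem_smul_top hf (ha n)
  obtain ⟨s, hs⟩ := hf (a 0)
  -- Lifting the successive differences, not the terms, keeps the lifted sequence Cauchy.
  let b : ℕ → Fin r → R := fun n => s + ∑ k ∈ Finset.range n, c k
  have hb : ∀ n, b (n + 1) - b n ∈ IsLocalRing.maximalIdeal R ^ n •
      (⊤ : Submodule R (Fin r → R)) := fun n => by
    have : b (n + 1) - b n = c n := by
      simp only [b, Finset.sum_range_succ]
      abel
    rw [this]
    exact hc n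
  have hfb : ∀ n, f (b n) = a n := fun n => by
    simp only [b, map_add, map_sum, hfc, hs, Finset.sum_range_sub]
    abel
  have hlim : ∀ i, ∃ L : R, ∀ n, b n i ≡ L
      [SMOD (IsLocalRing.maximalIdeal R ^ n • (⊤ : Submodule R R))] := fun i =>
    IsPrecomplete.prec inferInstance fun {m n} hmn => by
      refine (SModEq.sub_mem.2 ?_).symm
      exact pi_mem_smul_top_iff.1 (sub_mem_pow_of_succ hb hmn) i
  choose L hL using hlim
  refine ⟨f L, fun n => ?_⟩
  rw [← hfb, ← map_sub]
  exact map_mem_smul_top f (pi_mem_smul_top_iff.2 fun i => SModEq.sub_mem.1 (hL i n).symm)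

/-- The limit exists in the topology of the maximal ideal, where $\mathfrak a^n A$ is closed by
Krull's intersection theorem applied to $A/\mathfrak a^n A$. -/
theorem exists_limit [IsNoetherianRing R] {𝔞 : Ideal R} (h𝔞 : 𝔞 ≠ ⊤) {a : ℕ → A}
    (ha : ∀ n, a (n + 1) - a n ∈ 𝔞 ^ n • (⊤ : Submodule R A)) :
    ∃ x, ∀ n, x - a n ∈ 𝔞 ^ n • (⊤ : Submodule R A) := by
  have hle := IsLocalRing.le_maximalIdeal h𝔞
  obtain ⟨x, hx⟩ := exists_limit_maximalIdeal fun n =>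
    smul_top_mono (Ideal.pow_right_mono hle n) (ha n)
  refine ⟨x, fun n => ?_⟩
  rw [← Submodule.Quotient.mk_eq_zero]
  refine eq_zero_of_forall_mem_pow (𝔞 := IsLocalRing.maximalIdeal R)
    (Ideal.IsPrime.ne_top inferInstance) fun k => ?_
  let q := (𝔞 ^ n • (⊤ : Submodule R A)).mkQ
  change q _ ∈ _
  have h1 : q (x - a n) = q (x - a (max n k)) := by
    rw [← sub_eq_zero, ← map_sub, sub_sub_sub_cancel_left]
    exact (Submodule.Quotient.mk_eq_zero _).2 (sub_mem_pow_of_succ ha (le_max_left n k))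
  rw [h1]
  exact map_mem_smul_top q (smul_top_mono (Ideal.pow_le_pow_right (le_max_right n k)) (hx _))

end Complete

/-! ### Lifting idempotents -/

section Idempotent

variable {R : Type u} [CommRing R] {A : Type*} [Ring A] [Algebra R A]

theorem mul_mem_smul_top {I J : Ideal R} {x y : A} (hx : x ∈ I • (⊤ : Submodule R A))
    (hy : y ∈ J • (⊤ : Submodule R A)) : x * y ∈ (I * J) • (⊤ : Submodule R A) := by
  induction hx using Submodule.smul_induction_on' with
  | smul a ha x _ =>
    rw [smul_mul_assoc, Submodule.mul_smul]
    exact Submodule.smul_mem_smul ha (map_mem_smul_top (LinearMap.mulLeft R x) hy)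
  | add x _ x' _ hx hx' => rw [add_mul]; exact add_mem hx hx'

theorem mul_mem_smul_top_left {I : Ideal R} (x : A) {y : A}
    (hy : y ∈ I • (⊤ : Submodule R A)) : x * y ∈ I • (⊤ : Submodule R A) :=
  map_mem_smul_top (LinearMap.mulLeft R x) hy

theorem mul_mem_smul_top_right {I : Ideal R} {x : A} (y : A)
    (hx : x ∈ I • (⊤ : Submodule R A)) : x * y ∈ I • (⊤ : Submodule R A) :=
  map_mem_smul_top (LinearMap.mulRight R y) hx

variable [IsNoetherianRing R] [IsLocalRing R] [IsAdicComplete (IsLocalRing.maximalIdeal R) R]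
  [Module.Finite R A]

theorem exists_isIdempotentElem {𝔞 : Ideal R} (h𝔞 : 𝔞 ≠ ⊤) (x : A)
    (hx : x * x - x ∈ 𝔞 • (⊤ : Submodule R A)) :
    ∃ e : A, e * e = e ∧ e - x ∈ 𝔞 • (⊤ : Submodule R A) := by
  -- Newton's polynomial $3y^2 - 2y^3$: the new defect is divisible by $(y^2 - y)^2$. Gaining a
  -- single power of `𝔞` per step is enough.
  let a : ℕ → A := fun n => Nat.rec x (fun _ y => 3 * (y * y) - 2 * (y * y * y)) n
  have ha0 : a 0 = x := rfl
  have has : ∀ n, a (n + 1) = 3 * (a n * a n) - 2 * (a n * a n * a n) := fun _ => rfl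
  have h1 : ∀ n, a n * a n - a n ∈ 𝔞 ^ (n + 1) • (⊤ : Submodule R A) := by
    intro n
    induction n with
    | zero => simpa [ha0] using hx
    | succ n ih =>
      have : a (n + 1) * a (n + 1) - a (n + 1) =
          (a n * a n - a n) * (a n * a n - a n) * (4 * (a n * a n) - 4 * a n - 3) := by
        rw [has]; noncomm_ring
      rw [this]
      refine mul_mem_smul_top_right _ (smul_top_mono ?_ (mul_mem_smul_top ih ih))
      rw [← pow_add]
      exact Ideal.pow_le_pow_right (by omega)
  have h2 : ∀ n, a (n + 1) - a n ∈ 𝔞 ^ (n + 1) • (⊤ : Submodule R A) := fun n => by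
    have : a (n + 1) - a n = (a n * a n - a n) * (1 - 2 * a n) := by
      rw [has]; noncomm_ring
    rw [this]
    exact mul_mem_smul_top_right _ (h1 n)
  obtain ⟨e, he⟩ := exists_limit h𝔞 fun n => smul_top_mono (Ideal.pow_le_pow_right n.le_succ) (h2 n)
  refine ⟨e, sub_eq_zero.1 (eq_zero_of_forall_mem_pow h𝔞 fun n => ?_), ?_⟩
  · have : e * e - e = (e - a n) * e + a n * (e - a n) + (a n * a n - a n) - (e - a n) := by
      noncomm_ring
    rw [this]
    refine sub_mem (add_mem (add_mem ?_ ?_) ?_) (he n)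
    · exact mul_mem_smul_top_right _ (he n)
    · exact mul_mem_smul_top_left _ (he n)
    · exact smul_top_mono (Ideal.pow_le_pow_right n.le_succ) (h1 n)
  · have h3 := add_mem (he 1) (by simpa using h2 0 : a 1 - a 0 ∈ 𝔞 ^ 1 • (⊤ : Submodule R A))
    rwa [pow_one, sub_add_sub_cancel, ha0] at h3

end Idempotent

/-! ### Deforming differentials -/

section Deform

variable {R : Type u} [CommRing R] {A : Type u} [Ring A] [Algebra R A]

/-- The families `x i ∈ e (i + k) A e i` of degree `k`, which stand for the morphisms of degree `k`
from the graded object with components `e i` to itself. -/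
def gradedHom (R : Type u) [CommRing R] {A : Type u} [Ring A] [Algebra R A] (e : ℤ → A) (k : ℕ) :
    Submodule R (ℤ → A) where
  carrier := {x | ∀ i, e (i + k) * x i = x i ∧ x i * e i = x i}
  add_mem' hx hy i := by
    simp only [Pi.add_apply, mul_add, add_mul, (hx i).1, (hx i).2, (hy i).1, (hy i).2, and_self]
  zero_mem' i := by simp
  smul_mem' c x hx i := by
    simp only [Pi.smul_apply, mul_smul_comm, smul_mul_assoc, (hx i).1, (hx i).2, and_self]

theorem IsPowerSummand.trans {M A E : Type u} [AddCommGroup M] [Module R M] [AddCommGroup A]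
    [Module R A] [AddCommGroup E] [Module R E] (h : IsPowerSummand R M A)
    (h' : IsPowerSummand R A E) : IsPowerSummand R M E := by
  obtain ⟨ι, _, i, r, hir⟩ := h
  obtain ⟨κ, _, i', r', hir'⟩ := h'
  refine ⟨κ × ι, inferInstance, fun p => i p.2 ∘ₗ i' p.1, fun p => r' p.1 ∘ₗ r p.2, ?_⟩
  rw [Fintype.sum_prod_type, ← hir']
  refine Finset.sum_congr rfl fun t _ => LinearMap.ext fun x => ?_
  have := congrArg (r' t) (LinearMap.congr_fun hir (i' t x))
  simpa [LinearMap.sum_apply] using this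

variable {e : ℤ → A} (he : ∀ i, e i * e i = e i)

variable (R) in
/-- The family concentrated in one place. -/
def gradedHom.single (k : ℕ) (s : ℤ) : A →ₗ[R] gradedHom R e k where
  toFun y := ⟨Pi.single s (e (s + k) * y * e s), fun i => by
    by_cases h : i = s
    · subst h
      simp only [Pi.single_eq_same, ← mul_assoc, he, true_and]
      rw [mul_assoc _ (e i) (e i), he]
    · simp [Pi.single_eq_of_ne h]⟩
  map_add' x y := Subtype.ext (by simp [mul_add, add_mul, Pi.single_add])
  map_smul' c x := Subtype.ext (by simp [← Pi.single_smul])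

variable {a b : ℤ} (hab : ∀ i, i ∉ Finset.Icc a b → e i = 0)
include hab

theorem gradedHom.sum_single (k : ℕ) (x : gradedHom R e k) :
    ∑ s : Finset.Icc a b, gradedHom.single R he k s (x.1 s) = x := by
  refine Subtype.ext (funext fun i => ?_)
  have h1 : ∀ s : Finset.Icc a b, (gradedHom.single R he k s (x.1 s)).1 i =
      if i = s then x.1 i else 0 := fun s => by
    change Pi.single (M := fun _ => A) (s : ℤ) _ i = _
    split_ifs with h
    · subst h
      rw [Pi.single_eq_same, (x.2 _).1, (x.2 _).2]
    · exact Pi.single_eq_of_ne h _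
  rw [AddSubmonoidClass.coe_finsetSum, Finset.sum_apply]
  simp only [h1]
  by_cases hi : i ∈ Finset.Icc a b
  · rw [Finset.sum_eq_single ⟨i, hi⟩]
    · simp
    · intro s _ hs
      exact if_neg fun h => hs (Subtype.ext h.symm)
    · simp
  · rw [Finset.sum_eq_zero, ← (x.2 i).2, hab i hi, mul_zero]
    intro s _
    exact if_neg fun h => hi (by rw [h]; exact s.2)

include he in
theorem gradedHom.isPowerSummand (k : ℕ) : IsPowerSummand R A (gradedHom R e k) :=
  ⟨Finset.Icc a b, inferInstance, fun s => LinearMap.proj (s : ℤ) ∘ₗ (gradedHom R e k).subtype,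
    fun s => gradedHom.single R he k s, LinearMap.ext fun x => by
      simpa using gradedHom.sum_single he hab k x⟩

include he in
theorem gradedHom.mem_smul_top_iff (k : ℕ) {I : Ideal R} {x : gradedHom R e k} :
    x ∈ I • (⊤ : Submodule R (gradedHom R e k)) ↔ ∀ i, x.1 i ∈ I • (⊤ : Submodule R A) := by
  constructor
  · intro h i
    exact map_mem_smul_top (LinearMap.proj i ∘ₗ (gradedHom R e k).subtype) h
  · intro h
    rw [← gradedHom.sum_single he hab k x]
    exact sum_mem fun s _ => map_mem_smul_top (gradedHom.single R he k s) (h s)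

/-- A degree above the amplitude sends every nonzero component outside $[a, b]$. This starts the
descending induction. -/
theorem gradedHom.subsingleton {k : ℕ} (hk : b - a < k) : Subsingleton (gradedHom R e k) := by
  refine ⟨fun x y => ?_⟩
  have h0 : ∀ (x : gradedHom R e k) i, x.1 i = 0 := fun x i => by
    by_cases hi : i ∈ Finset.Icc a b
    · rw [← (x.2 i).1, hab (i + k), zero_mul]
      rw [Finset.mem_Icc] at hi ⊢
      omega
    · rw [← (x.2 i).2, hab i hi, mul_zero]
  exact Subtype.ext (funext fun i => by rw [h0, h0])

omit hab

/-- The commutator with a family of degree one. -/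
def gradedHom.diff {d : ℤ → A} (hd : d ∈ gradedHom R e 1) (k : ℕ) :
    gradedHom R e k →ₗ[R] gradedHom R e (k + 1) where
  toFun x := ⟨fun i => d (i + k) * x.1 i - (-1) ^ k * x.1 (i + 1) * d i, fun i => by
    have h1 := (hd (i + k)).1
    have h2 := (x.2 (i + 1)).1
    have h3 : i + ((k + 1 : ℕ) : ℤ) = i + k + 1 := by push_cast; ring
    rw [Nat.cast_one] at h1
    rw [add_right_comm] at h2
    rw [h3, mul_sub, sub_mul, ← mul_assoc, h1, mul_assoc (d _), (x.2 i).2,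
      mul_assoc _ (d i), (hd i).2, ← mul_assoc, ← mul_assoc,
      ← ((Commute.neg_one_left _).pow_left k).eq,
      mul_assoc _ (e _), h2]
    exact ⟨rfl, rfl⟩⟩
  map_add' x y := Subtype.ext (funext fun i => by
    simp only [Submodule.coe_add, Pi.add_apply]; noncomm_ring)
  map_smul' c x := Subtype.ext (funext fun i => by
    simp [smul_sub])

theorem gradedHom.diff_apply {d : ℤ → A} (hd : d ∈ gradedHom R e 1) (k : ℕ)
    (x : gradedHom R e k) (i : ℤ) :
    (gradedHom.diff hd k x).1 i = d (i + k) * x.1 i - (-1) ^ k * x.1 (i + 1) * d i := rfl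

/-- The mixed terms cancel by sign, leaving $[d^2, x]$, which lies in $\mathfrak a$ as soon as $d^2$
does. -/
theorem gradedHom.diff_diff_apply {d : ℤ → A} (hd : d ∈ gradedHom R e 1) (k : ℕ)
    (x : gradedHom R e k) (i : ℤ) :
    (gradedHom.diff hd (k + 1) (gradedHom.diff hd k x)).1 i =
      d (i + k + 1) * d (i + k) * x.1 i - x.1 (i + 1 + 1) * (d (i + 1) * d i) := by
  have h3 : i + ((k + 1 : ℕ) : ℤ) = i + k + 1 := by push_cast; ring
  have h4 : i + 1 + (k : ℤ) = i + k + 1 := by ring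
  have h5 : ((-1 : A) ^ k) * (-1) ^ k = 1 := by
    rw [← pow_add, ← two_mul, pow_mul]; simp
  have h6 : ∀ z : A, (-1 : A) ^ k * z = z * (-1) ^ k :=
    fun z => ((Commute.neg_one_left _).pow_left k).eq
  rw [diff_apply, diff_apply, diff_apply, h3, h4, pow_succ]
  generalize (-1 : A) ^ k = s at h5 h6 ⊢
  have h7 : s * -1 * (d (i + k + 1) * x.1 (i + 1) - s * x.1 (i + 1 + 1) * d (i + 1)) * d i =
      - (d (i + k + 1) * (s * x.1 (i + 1) * d i)) + s * s * x.1 (i + 1 + 1) * (d (i + 1) * d i) := by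
    rw [mul_sub, sub_mul, mul_neg_one, neg_mul, neg_mul, ← mul_assoc s, h6 (d _)]
    noncomm_ring
  rw [h7, h5]
  noncomm_ring

end Deform

/-! ### Successive correction of the differential -/

section Deform2

variable {R : Type u} [CommRing R] [IsNoetherianRing R] {A : Type u} [Ring A] [Algebra R A]

theorem exists_better_differential {M : Type u} [AddCommGroup M] [Module R M]
    (hA : IsPowerSummand R M A) {𝔞 : Ideal R}
    (hM : ∀ n, 0 < n → ∀ k, TorVan R M k (R ⧸ 𝔞 ^ n))
    {e : ℤ → A} (he : ∀ i, e i * e i = e i) {a b : ℤ} (hab : ∀ i, i ∉ Finset.Icc a b → e i = 0)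
    {d : ℤ → A} (hd : d ∈ gradedHom R e 1)
    (hdd : ∀ i, d (i + 1) * d i ∈ 𝔞 • (⊤ : Submodule R A))
    (hex : ∀ (k : ℕ), 1 ≤ k → ∀ x ∈ gradedHom R e (k + 1),
      (∀ i, d (i + (k + 1 : ℕ)) * x i - (-1) ^ (k + 1) * x (i + 1) * d i ∈
        𝔞 • (⊤ : Submodule R A)) →
      ∃ y ∈ gradedHom R e k, ∀ i, x i - (d (i + k) * y i - (-1) ^ k * y (i + 1) * d i) ∈
        𝔞 • (⊤ : Submodule R A))
    {n : ℕ} (hn : 0 < n) {D : ℤ → A} (hD : D ∈ gradedHom R e 1)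
    (hDd : ∀ i, D i - d i ∈ 𝔞 • (⊤ : Submodule R A))
    (hDD : ∀ i, D (i + 1) * D i ∈ 𝔞 ^ n • (⊤ : Submodule R A)) :
    ∃ D' ∈ gradedHom R e 1, (∀ i, D' i - d i ∈ 𝔞 • (⊤ : Submodule R A)) ∧
      (∀ i, D' i - D i ∈ 𝔞 ^ n • (⊤ : Submodule R A)) ∧
      ∀ i, D' (i + 1) * D' i ∈ 𝔞 ^ (n + 1) • (⊤ : Submodule R A) := by
  have e2 : ∀ i : ℤ, i + ((1 + 1 : ℕ) : ℤ) = i + 1 + 1 := fun i => by push_cast; ring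
  have hD1 : ∀ i, e (i + 1) * D i = D i := fun i => by simpa using (hD i).1
  let x : gradedHom R e (1 + 1) := ⟨fun i => D (i + 1) * D i, fun i => by
    rw [e2, ← mul_assoc, hD1, mul_assoc, (hD i).2]
    exact ⟨rfl, rfl⟩⟩
  have memP : ∀ {y z : A}, y ∈ 𝔞 • (⊤ : Submodule R A) → z ∈ 𝔞 ^ n • (⊤ : Submodule R A) →
      y * z ∈ 𝔞 ^ (n + 1) • (⊤ : Submodule R A) ∧ z * y ∈ 𝔞 ^ (n + 1) • (⊤ : Submodule R A) := by
    intro y z hy hz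
    have h1 := mul_mem_smul_top hy hz
    have h2 := mul_mem_smul_top hz hy
    rw [← pow_succ'] at h1
    rw [← pow_succ] at h2
    exact ⟨h1, h2⟩
  have hdD : ∀ i, d i - D i ∈ 𝔞 • (⊤ : Submodule R A) := fun i => by
    rw [← neg_sub]; exact neg_mem (hDd i)
  -- The complex is shifted by one so that index 0 is degree one, where the correction `y` lives;
  -- then `x`, which is $D^2$, has degree two and exactness is needed only from there on.
  obtain ⟨y, hy, hxy⟩ := exists_sub_mem_pow_succ (M := M) (fun j => gradedHom R e (j + 1))
    (fun j => gradedHom.diff hd (j + 1)) 𝔞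
    (fun j => hA.trans (gradedHom.isPowerSummand he hab (j + 1))) hM
    (fun j x => (gradedHom.mem_smul_top_iff he hab _).2 fun i => by
      rw [gradedHom.diff_diff_apply]
      have := hdd (i + (j + 1 : ℕ))
      exact sub_mem (mul_mem_smul_top_right _ this) (mul_mem_smul_top_left _ (hdd i)))
    (fun j x hx => by
      obtain ⟨y, hy, hxy⟩ := hex (j + 1) (by omega) x.1 x.2
        ((gradedHom.mem_smul_top_iff he hab _).1 hx)
      exact ⟨⟨y, hy⟩, (gradedHom.mem_smul_top_iff he hab _).2 hxy⟩)
    (b - a).toNat (fun j hj => gradedHom.subsingleton hab (by omega)) 0 n hn x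
    ((gradedHom.mem_smul_top_iff he hab _).2 hDD)
    ((gradedHom.mem_smul_top_iff he hab _).2 fun i => by
      rw [gradedHom.diff_apply]
      -- The Bianchi identity $[D, D^2] = 0$ turns $[d, D^2]$ into $[d - D, D^2]$, which gains a
      -- factor `𝔞`.
      have h1 : d (i + ((0 + 1 + 1 : ℕ) : ℤ)) * x.1 i -
          (-1) ^ (0 + 1 + 1) * x.1 (i + 1) * d i =
          (d (i + 1 + 1) - D (i + 1 + 1)) * (D (i + 1) * D i) -
          (D (i + 1 + 1) * D (i + 1)) * (d i - D i) := by
        have : i + ((0 + 1 + 1 : ℕ) : ℤ) = i + 1 + 1 := by push_cast; ring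
        rw [this]
        simp only [x]
        noncomm_ring
      rw [h1]
      exact sub_mem (memP (hdD _) (hDD i)).1 (memP (hdD i) (hDD (i + 1))).2)
  have hy' := (gradedHom.mem_smul_top_iff he hab _).1 hy
  have hxy' := (gradedHom.mem_smul_top_iff he hab _).1 hxy
  refine ⟨D - y.1, sub_mem hD y.2, fun i => ?_, fun i => ?_, fun i => ?_⟩
  · rw [Pi.sub_apply, sub_right_comm]
    refine sub_mem (hDd i) (smul_top_mono ?_ (hy' i))
    exact Ideal.pow_le_self hn.ne'
  · rw [Pi.sub_apply, sub_sub_cancel_left]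
    exact neg_mem (hy' i)
  · have h1 : (D - y.1) (i + 1) * (D - y.1) i =
        (x.1 i - (d (i + ((0 + 1 : ℕ) : ℤ)) * y.1 i - (-1) ^ (0 + 1) * y.1 (i + 1) * d i)) +
        (d (i + 1) - D (i + 1)) * y.1 i + y.1 (i + 1) * (d i - D i) + y.1 (i + 1) * y.1 i := by
      simp only [x, Pi.sub_apply, Nat.zero_add, Nat.cast_one, pow_one]
      noncomm_ring
    rw [h1]
    refine add_mem (add_mem (add_mem (hxy' i) ?_) ?_) ?_
    · exact (memP (hdD _) (hy' i)).1
    · exact (memP (hdD _) (hy' _)).2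
    · exact (memP (smul_top_mono (Ideal.pow_le_self hn.ne') (hy' (i + 1))) (hy' i)).1

variable [IsLocalRing R] [IsAdicComplete (IsLocalRing.maximalIdeal R) R] [Module.Finite R A]

theorem exists_differential {M : Type u} [AddCommGroup M] [Module R M]
    (hA : IsPowerSummand R M A) {𝔞 : Ideal R} (h𝔞 : 𝔞 ≠ ⊤)
    (hM : ∀ n, 0 < n → ∀ k, TorVan R M k (R ⧸ 𝔞 ^ n))
    {e : ℤ → A} (he : ∀ i, e i * e i = e i) {a b : ℤ} (hab : ∀ i, i ∉ Finset.Icc a b → e i = 0)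
    {d : ℤ → A} (hd : d ∈ gradedHom R e 1)
    (hdd : ∀ i, d (i + 1) * d i ∈ 𝔞 • (⊤ : Submodule R A))
    (hex : ∀ (k : ℕ), 1 ≤ k → ∀ x ∈ gradedHom R e (k + 1),
      (∀ i, d (i + (k + 1 : ℕ)) * x i - (-1) ^ (k + 1) * x (i + 1) * d i ∈
        𝔞 • (⊤ : Submodule R A)) →
      ∃ y ∈ gradedHom R e k, ∀ i, x i - (d (i + k) * y i - (-1) ^ k * y (i + 1) * d i) ∈
        𝔞 • (⊤ : Submodule R A)) :
    ∃ D ∈ gradedHom R e 1, (∀ i, D i - d i ∈ 𝔞 • (⊤ : Submodule R A)) ∧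
      ∀ i, D (i + 1) * D i = 0 := by
  let P : ℕ → Type u := fun n => {D : ℤ → A // D ∈ gradedHom R e 1 ∧
    (∀ i, D i - d i ∈ 𝔞 • (⊤ : Submodule R A)) ∧
    ∀ i, D (i + 1) * D i ∈ 𝔞 ^ (n + 1) • (⊤ : Submodule R A)}
  have step : ∀ n (D : P n), ∃ D' : P (n + 1),
      ∀ i, D'.1 i - D.1 i ∈ 𝔞 ^ (n + 1) • (⊤ : Submodule R A) := fun n D => by
    obtain ⟨D', h1, h2, h3, h4⟩ := exists_better_differential hA hM he hab hd hdd hex n.succ_pos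
      D.2.1 D.2.2.1 D.2.2.2
    exact ⟨⟨D', h1, h2, h4⟩, h3⟩
  choose next hnext using step
  -- The exponent in `P n` is `n + 1`, so `d` itself starts the recursion. All required identities
  -- pass to the limit by separatedness.
  let D : ∀ n, P n := fun n => Nat.rec ⟨d, hd, fun i => by simp, fun i => by simpa using hdd i⟩
    next n
  have hD : ∀ n i, (D (n + 1)).1 i - (D n).1 i ∈ 𝔞 ^ n • (⊤ : Submodule R A) := fun n i =>
    smul_top_mono (Ideal.pow_le_pow_right n.le_succ) (hnext n (D n) i)
  choose L hL using fun i => exists_limit h𝔞 (a := fun n => (D n).1 i) fun n => hD n i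
  refine ⟨L, fun i => ⟨?_, ?_⟩, fun i => ?_, fun i => ?_⟩
  · refine sub_eq_zero.1 (eq_zero_of_forall_mem_pow h𝔞 fun n => ?_)
    have : e (i + (1 : ℕ)) * L i - L i =
        e (i + (1 : ℕ)) * (L i - (D n).1 i) - (L i - (D n).1 i) := by
      rw [mul_sub, ((D n).2.1 i).1]; abel
    rw [this]
    exact sub_mem (mul_mem_smul_top_left _ (hL i n)) (hL i n)
  · refine sub_eq_zero.1 (eq_zero_of_forall_mem_pow h𝔞 fun n => ?_)
    have : L i * e i - L i = (L i - (D n).1 i) * e i - (L i - (D n).1 i) := by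
      rw [sub_mul, ((D n).2.1 i).2]; abel
    rw [this]
    exact sub_mem (mul_mem_smul_top_right _ (hL i n)) (hL i n)
  · rw [← sub_add_sub_cancel _ ((D 1).1 i)]
    exact add_mem (by simpa using hL i 1) ((D 1).2.2.1 i)
  · refine eq_zero_of_forall_mem_pow h𝔞 fun n => ?_
    have : L (i + 1) * L i = (L (i + 1) - (D n).1 (i + 1)) * L i +
        (D n).1 (i + 1) * (L i - (D n).1 i) + (D n).1 (i + 1) * (D n).1 i := by
      noncomm_ring
    rw [this]
    refine add_mem (add_mem ?_ ?_) ?_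
    · exact mul_mem_smul_top_right _ (hL _ n)
    · exact mul_mem_smul_top_left _ (hL _ n)
    · exact smul_top_mono (Ideal.pow_le_pow_right n.le_succ) ((D n).2.2.2 i)

end Deform2

/-! ### Complexes whose terms are retracts of a fixed object -/

section Retracts

universe v₁ v₂ u₁ u₂

open CochainComplex.HomComplex in
-- A bounded above complex of projectives is K-projective, so a cocycle that is zero in the derived
-- category is a coboundary. The retractions carry this to endomorphisms of the single object `F`.
theorem exists_homotopy_of_retracts {C : Type u₁} [Category.{v₁} C] [Abelian C]
    [HasDerivedCategory.{w} C] (K : CochainComplex C ℤ) (b : ℤ) [K.IsStrictlyLE b]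
    [∀ i, Projective (K.X i)] (n m : ℤ) (hnm : n + 1 = m)
    (hK : ∀ g : DerivedCategory.Q.obj K ⟶ (DerivedCategory.Q.obj K)⟦m⟧, g = 0)
    {F : C} (s : ∀ i, K.X i ⟶ F) (r : ∀ i, F ⟶ K.X i) (hsr : ∀ i, s i ≫ r i = 𝟙 _)
    (d : ℤ → (F ⟶ F)) (hd : ∀ i, d i = r i ≫ K.d i (i + 1) ≫ s (i + 1))
    (x : ℤ → (F ⟶ F)) (hx : ∀ i, r i ≫ s i ≫ x i = x i)
    (hx' : ∀ i, x i ≫ r (i + m) ≫ s (i + m) = x i)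
    (hdx : ∀ i, x i ≫ d (i + m) = m.negOnePow • d i ≫ x (i + 1)) :
    ∃ y : ℤ → (F ⟶ F), (∀ i, r i ≫ s i ≫ y i = y i) ∧
      (∀ i, y i ≫ r (i + n) ≫ s (i + n) = y i) ∧
      ∀ i, x i = y i ≫ d (i + n) + m.negOnePow • d i ≫ y (i + 1) := by
  let α : Cochain K K m := Cochain.mk fun p q _ => s p ≫ x p ≫ r q
  have hα : ∀ p q hpq, α.v p q hpq = s p ≫ x p ≫ r q := fun _ _ _ => rfl
  have hrd : ∀ i, r i ≫ K.d i (i + 1) = d i ≫ r (i + 1) := fun i => by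
    simp only [hd, Category.assoc, hsr, Category.comp_id]
  have hds : ∀ i, K.d i (i + 1) ≫ s (i + 1) = s i ≫ d i := fun i => by
    rw [hd, reassoc_of% hsr i]
  have hδ : δ m (m + 1) α = 0 := by
    ext p q hpq
    rw [δ_v m (m + 1) rfl α p q hpq (p + m) (p + 1) (by omega) rfl, hα, hα, Cochain.zero_v]
    obtain rfl : q = p + m + 1 := by omega
    have h1 : (s p ≫ x p ≫ r (p + m)) ≫ K.d (p + m) (p + m + 1) =
        s p ≫ (x p ≫ d (p + m)) ≫ r (p + m + 1) := by
      simp only [Category.assoc, hrd]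
    have h2 : K.d p (p + 1) ≫ s (p + 1) ≫ x (p + 1) ≫ r (p + m + 1) =
        s p ≫ (d p ≫ x (p + 1)) ≫ r (p + m + 1) := by
      rw [reassoc_of% hds p]; simp only [Category.assoc]
    rw [h1, h2, hdx, Int.negOnePow_succ]
    simp
  let z : Cocycle K K m := Cocycle.mk α (m + 1) rfl hδ
  have hz : z ∈ coboundaries K K m := by
    rw [← CohomologyClass.toHom_mk_eq_zero_iff]
    have := CochainComplex.isKProjective_of_projective K b
    apply (CochainComplex.IsKProjective.Qh_map_bijective (K := K)
      ((HomotopyCategory.quotient C (ComplexShape.up ℤ)).obj (K⟦m⟧))).1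
    rw [Functor.map_zero]
    let i : DerivedCategory.Q.obj (K⟦m⟧) ≅ (DerivedCategory.Q.obj K)⟦m⟧ :=
      (DerivedCategory.Q.commShiftIso m).app K
    let g : DerivedCategory.Q.obj K ⟶ DerivedCategory.Q.obj (K⟦m⟧) :=
      DerivedCategory.Qh.map (CohomologyClass.toHom (CohomologyClass.mk z))
    change g = 0
    rw [← cancel_mono i.hom, hK (g ≫ i.hom), Limits.zero_comp]
  obtain ⟨β, hβ⟩ := (mem_coboundaries_iff z n hnm).1 hz
  refine ⟨fun i => r i ≫ β.v i (i + n) rfl ≫ s (i + n), fun i => ?_, fun i => ?_, fun i => ?_⟩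
  · rw [reassoc_of% hsr i]
  · simp only [Category.assoc, reassoc_of% hsr (i + n)]
  · have h := Cochain.congr_v hβ i (i + m) rfl
    rw [δ_v n m hnm β i (i + m) rfl (i + n) (i + 1) (by omega) rfl] at h
    change _ = s i ≫ x i ≫ r (i + m) at h
    have h1 : x i = r i ≫ (s i ≫ x i ≫ r (i + m)) ≫ s (i + m) := by
      simp only [Category.assoc, hx', hx]
    obtain rfl : m = n + 1 := hnm.symm
    -- The target degree is a variable `q` because `i + n + 1` and `i + 1 + n` are only
    -- propositionally equal.
    have key : ∀ q (hq : q = i + n + 1) (hq' : i + 1 + n = q),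
        r i ≫ (β.v i (i + n) rfl ≫ K.d (i + n) q + (n + 1).negOnePow • K.d i (i + 1) ≫
          β.v (i + 1) q hq') ≫ s q =
        (r i ≫ β.v i (i + n) rfl ≫ s (i + n)) ≫ d (i + n) +
          (n + 1).negOnePow • d i ≫ r (i + 1) ≫ β.v (i + 1) (i + 1 + n) rfl ≫ s (i + 1 + n) := by
      rintro q hq rfl
      rw [Preadditive.add_comp, Preadditive.comp_add]
      congr 1
      · simp only [Category.assoc]
        have : i + 1 + n = i + n + 1 := by omega
        rw [this, hds]
      · simp only [Linear.units_smul_comp, Linear.comp_units_smul, Category.assoc,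
          reassoc_of% hrd i]
    rw [h1, ← h, key _ (by omega) (by omega)]

/-- Both complexes are cut out of $G(F) \cong F'$ by matching idempotents and differentials, so the
composites inclusion, `θ`, retraction are isomorphisms of complexes. -/
theorem nonempty_iso_of_retracts {C : Type u₁} [Category.{v₁} C] [Preadditive C] {D : Type u₂}
    [Category.{v₂} D] [Preadditive D] (G : C ⥤ D) [G.Additive] (L : CochainComplex C ℤ)
    (K : CochainComplex D ℤ) {F : C} {F' : D} (θ : G.obj F ≅ F')
    (ι : ∀ i, L.X i ⟶ F) (π : ∀ i, F ⟶ L.X i) (hι : ∀ i, ι i ≫ π i = 𝟙 _)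
    (s : ∀ i, K.X i ⟶ F') (r : ∀ i, F' ⟶ K.X i) (hsr : ∀ i, s i ≫ r i = 𝟙 _)
    (he : ∀ i, G.map (π i ≫ ι i) ≫ θ.hom = θ.hom ≫ r i ≫ s i)
    (Δ : ℤ → (F ⟶ F)) (hΔ : ∀ i, L.d i (i + 1) = ι i ≫ Δ i ≫ π (i + 1))
    (hd : ∀ i, G.map (Δ i) ≫ θ.hom = θ.hom ≫ r i ≫ K.d i (i + 1) ≫ s (i + 1)) :
    Nonempty ((G.mapHomologicalComplex (ComplexShape.up ℤ)).obj L ≅ K) := by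
  have hG : ∀ i, G.map (ι i) ≫ G.map (π i) = 𝟙 _ := fun i => by
    rw [← G.map_comp, hι, G.map_id]
  have he' : ∀ i, G.map (π i) ≫ G.map (ι i) ≫ θ.hom = θ.hom ≫ r i ≫ s i := fun i => by
    rw [← he, G.map_comp, Category.assoc]
  refine ⟨HomologicalComplex.Hom.isoOfComponents (fun i =>
    { hom := G.map (ι i) ≫ θ.hom ≫ r i
      inv := s i ≫ θ.inv ≫ G.map (π i)
      hom_inv_id := ?_
      inv_hom_id := ?_ }) ?_⟩
  · have h1 : (G.map (ι i) ≫ θ.hom ≫ r i) ≫ s i ≫ θ.inv ≫ G.map (π i) =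
        G.map (ι i) ≫ (θ.hom ≫ r i ≫ s i) ≫ θ.inv ≫ G.map (π i) := by simp only [Category.assoc]
    have h2 : (G.map (ι i) ≫ θ.hom ≫ r i) ≫ s i ≫ θ.inv ≫ G.map (π i) = 𝟙 (G.obj (L.X i)) := by
      rw [h1, ← he']
      simp only [Category.assoc, Iso.hom_inv_id_assoc, reassoc_of% hG i, hG]
    exact h2
  · have : (s i ≫ θ.inv ≫ G.map (π i)) ≫ G.map (ι i) ≫ θ.hom ≫ r i = 𝟙 (K.X i) := by
      have h1 := reassoc_of% he' i
      simp only [Category.assoc, h1, Iso.inv_hom_id_assoc, hsr, reassoc_of% hsr i]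
    exact this
  · rintro i j (rfl : i + 1 = j)
    have h1 := reassoc_of% he' (i + 1)
    have h2 := reassoc_of% hd i
    have h3 : (G.map (ι i) ≫ θ.hom ≫ r i) ≫ K.d i (i + 1) =
        G.map (L.d i (i + 1)) ≫ G.map (ι (i + 1)) ≫ θ.hom ≫ r (i + 1) := by
      rw [hΔ, G.map_comp, G.map_comp]
      simp only [Category.assoc, h1, h2, hsr, Category.comp_id]
    exact h3

end Retracts

/-! ### Free right modules and their endomorphisms -/

section Free

variable {S : Type u} [Ring S] {n : ℕ}

/-- The endomorphism of the free right module `S ^ n` given by a matrix. -/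
def matrixMap (y : Matrix (Fin n) (Fin n) S) : (Fin n → S) →ₗ[Sᵐᵒᵖ] (Fin n → S) where
  toFun v := y.mulVec v
  map_add' := Matrix.mulVec_add y
  map_smul' c v := Matrix.mulVec_smul y c v

theorem matrixMap_apply (y : Matrix (Fin n) (Fin n) S) (v : Fin n → S) :
    matrixMap y v = y.mulVec v := rfl

theorem matrixMap_mul (y z : Matrix (Fin n) (Fin n) S) :
    matrixMap (y * z) = matrixMap y ∘ₗ matrixMap z :=
  LinearMap.ext fun v => (Matrix.mulVec_mulVec v y z).symm

theorem matrixMap_add (y z : Matrix (Fin n) (Fin n) S) :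
    matrixMap (y + z) = matrixMap y + matrixMap z :=
  LinearMap.ext fun v => Matrix.add_mulVec y z v

theorem matrixMap_neg (y : Matrix (Fin n) (Fin n) S) : matrixMap (-y) = -matrixMap y :=
  LinearMap.ext fun v => Matrix.neg_mulVec v y

theorem matrixMap_zero : matrixMap (0 : Matrix (Fin n) (Fin n) S) = 0 :=
  LinearMap.ext fun v => Matrix.zero_mulVec v

theorem free_hom_ext {N : Type*} [AddCommGroup N] [Module Sᵐᵒᵖ N]
    {φ ψ : (Fin n → S) →ₗ[Sᵐᵒᵖ] N} (h : ∀ j, φ (Pi.single j 1) = ψ (Pi.single j 1)) : φ = ψ := by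
  refine LinearMap.pi_ext fun j a => ?_
  have : (Pi.single j a : Fin n → S) = MulOpposite.op a • Pi.single j 1 := by
    rw [← Pi.single_smul]; simp
  rw [this, map_smul, map_smul, h]

theorem matrixMap_injective : Function.Injective (matrixMap (S := S) (n := n)) := by
  intro y z h
  ext i j
  have := congrFun (LinearMap.congr_fun h (Pi.single j 1)) i
  simpa [matrixMap_apply] using this

theorem matrixMap_surjective : Function.Surjective (matrixMap (S := S) (n := n)) := by
  intro φ
  refine ⟨Matrix.of fun i j => φ (Pi.single j 1) i, free_hom_ext fun j => ?_⟩
  ext i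
  simp [matrixMap_apply]

variable (S) in
/-- A ring as a free right module over itself. -/
def selfEquivOp : S ≃ₗ[Sᵐᵒᵖ] Sᵐᵒᵖ where
  __ := MulOpposite.opAddEquiv
  map_smul' _ _ := rfl

instance : Module.Finite Sᵐᵒᵖ S := Module.Finite.equiv (selfEquivOp S).symm

/-- Every large rank is allowed so that finitely many modules can share one free module. -/
theorem exists_retract (N : Type u) [AddCommGroup N] [Module Sᵐᵒᵖ N] [Module.Finite Sᵐᵒᵖ N]
    [Module.Projective Sᵐᵒᵖ N] : ∃ n₀, ∀ n, n₀ ≤ n →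
      ∃ (s : N →ₗ[Sᵐᵒᵖ] (Fin n → S)) (r : (Fin n → S) →ₗ[Sᵐᵒᵖ] N), r ∘ₗ s = LinearMap.id := by
  obtain ⟨n₀, f, hf⟩ := Module.Finite.exists_fin' Sᵐᵒᵖ N
  refine ⟨n₀, fun n hn => ?_⟩
  let e : (Fin n₀ → S) ≃ₗ[Sᵐᵒᵖ] (Fin n₀ → Sᵐᵒᵖ) := LinearEquiv.piCongrRight fun _ => selfEquivOp S
  let r : (Fin n → S) →ₗ[Sᵐᵒᵖ] N := f ∘ₗ e.toLinearMap ∘ₗ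
    LinearMap.funLeft Sᵐᵒᵖ S (Fin.castLE hn)
  have hr : Function.Surjective r := hf.comp (e.surjective.comp
    (LinearMap.funLeft_surjective_of_injective _ _ _ (Fin.castLE_injective hn)))
  obtain ⟨s, hs⟩ := Module.projective_lifting_property r LinearMap.id hr
  exact ⟨s, r, hs⟩

end Free

/-! ### Extension of scalars on free modules -/

section TensorFree

variable {A B : Type u} [Ring A] [Ring B] (f : A →+* B) (n : ℕ)

/-- The map `A ^ n ⊗ B → B ^ n` before passing to the quotient. -/
def preTensorFree : (B ⊗[ℤ] (Fin n → A)) →ₗ[Bᵐᵒᵖ] (Fin n → B) where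
  toFun := TensorProduct.lift (LinearMap.mk₂ ℤ (fun (b : B) (v : Fin n → A) j => f (v j) * b)
    (fun b b' v => funext fun j => mul_add _ _ _)
    (fun c b v => funext fun j => mul_smul_comm c (f (v j)) b)
    (fun b v v' => funext fun j => by simp [add_mul])
    (fun c b v => funext fun j => by simp [mul_assoc]))
  map_add' := map_add _
  map_smul' c x := by
    induction x using TensorProduct.induction_on with
    | zero => simp
    | tmul b m =>
      funext j
      simp [TensorProduct.smul_tmul', mul_assoc]
    | add x y hx hy => simp only [smul_add, map_add, hx, hy]

theorem preTensorFree_tmul (b : B) (v : Fin n → A) :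
    preTensorFree f n (b ⊗ₜ[ℤ] v) = fun j => f (v j) * b := rfl

/-- The map `A ^ n ⊗_A B → B ^ n`, `v ⊗ b ↦ v b`. -/
def tensorFree : RightTensor f (Fin n → A) →ₗ[Bᵐᵒᵖ] (Fin n → B) :=
  Submodule.liftQ _ (preTensorFree f n) <| Submodule.span_le.2 <| by
    rintro _ ⟨a, b, m, rfl⟩
    rw [SetLike.mem_coe, LinearMap.mem_ker, map_sub, preTensorFree_tmul, preTensorFree_tmul,
      sub_eq_zero]
    funext j
    simp [mul_assoc]

theorem tensorFree_mk (b : B) (v : Fin n → A) :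
    tensorFree f n (Submodule.Quotient.mk (b ⊗ₜ[ℤ] v)) = fun j => f (v j) * b := rfl

/-- The inverse of `tensorFree`. -/
def tensorFreeInv : (Fin n → B) →ₗ[Bᵐᵒᵖ] RightTensor f (Fin n → A) where
  toFun w := ∑ j, Submodule.Quotient.mk (w j ⊗ₜ[ℤ] Pi.single j 1)
  map_add' w w' := by
    simp only [Pi.add_apply, TensorProduct.add_tmul, Submodule.Quotient.mk_add,
      Finset.sum_add_distrib]
  map_smul' c w := by
    simp only [Pi.smul_apply, ← TensorProduct.smul_tmul', Submodule.Quotient.mk_smul,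
      Finset.smul_sum, RingHom.id_apply]

theorem tensorFreeInv_apply (w : Fin n → B) :
    tensorFreeInv f n w = ∑ j, Submodule.Quotient.mk (w j ⊗ₜ[ℤ] Pi.single j 1) := rfl

/-- The isomorphism `A ^ n ⊗_A B ≅ B ^ n` of right `B`-modules. -/
def extendScalarsFree : (extendScalars f).obj (ModuleCat.of Aᵐᵒᵖ (Fin n → A)) ≅
    ModuleCat.of Bᵐᵒᵖ (Fin n → B) where
  hom := ModuleCat.ofHom (tensorFree f n)
  inv := ModuleCat.ofHom (tensorFreeInv f n)
  hom_inv_id := ModuleCat.hom_ext <| rightTensor_hom_ext f fun b v => by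
    change tensorFreeInv f n (tensorFree f n (Submodule.Quotient.mk (b ⊗ₜ[ℤ] v))) =
      Submodule.Quotient.mk (b ⊗ₜ[ℤ] v)
    have h : ∀ j, (Submodule.Quotient.mk ((f (v j) * b) ⊗ₜ[ℤ] (Pi.single j 1 : Fin n → A)) :
        RightTensor f (Fin n → A)) = Submodule.Quotient.mk (b ⊗ₜ[ℤ] Pi.single j (v j)) := fun j => by
      rw [Submodule.Quotient.eq]
      refine Submodule.subset_span ⟨v j, b, Pi.single j 1, ?_⟩
      rw [← Pi.single_smul]; simp
    rw [tensorFree_mk, tensorFreeInv_apply]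
    simp only [h]
    change ∑ j, Submodule.mkQ (tensorRelations f (Fin n → A)) (b ⊗ₜ[ℤ] Pi.single j (v j)) =
      Submodule.mkQ _ (b ⊗ₜ[ℤ] v)
    rw [← map_sum, ← TensorProduct.tmul_sum]
    exact congrArg (fun v => Submodule.mkQ _ (b ⊗ₜ[ℤ] v)) (Finset.univ_sum_single v)
  inv_hom_id := ModuleCat.hom_ext <| LinearMap.ext fun w => by
    change tensorFree f n (tensorFreeInv f n w) = w
    rw [tensorFreeInv_apply, map_sum]
    simp only [tensorFree_mk]
    funext i
    rw [Finset.sum_apply, Finset.sum_eq_single i]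
    · simp
    · intro j _ hj
      simp [Pi.single_eq_of_ne hj.symm]
    · simp

/-- In the standard bases, base change along `f` applies `f` to the matrix entries. Hence lifting
matrices along `f` lifts morphisms of free modules. -/
theorem extendScalars_map_matrixMap (y : Matrix (Fin n) (Fin n) A) :
    (extendScalars f).map (ModuleCat.ofHom (matrixMap y)) ≫ (extendScalarsFree f n).hom =
      (extendScalarsFree f n).hom ≫ ModuleCat.ofHom (matrixMap (f.mapMatrix y)) :=
  ModuleCat.hom_ext <| rightTensor_hom_ext f fun b v => by
    change tensorFree f n (Submodule.Quotient.mk (b ⊗ₜ[ℤ] (y.mulVec v))) =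
      (f.mapMatrix y).mulVec (tensorFree f n (Submodule.Quotient.mk (b ⊗ₜ[ℤ] v)))
    rw [tensorFree_mk, tensorFree_mk]
    funext j
    simp [Matrix.mulVec, dotProduct, map_sum, Finset.sum_mul, mul_assoc]

end TensorFree

/-! ### Lifting idempotents and differential together -/

section LiftComplex

variable {R : Type u} [CommRing R] [IsNoetherianRing R] [IsLocalRing R]
  [IsAdicComplete (IsLocalRing.maximalIdeal R) R] {A : Type u} [Ring A] [Algebra R A]
  [Module.Finite R A]

theorem exists_lift_idempotents_differential {M : Type u} [AddCommGroup M] [Module R M]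
    (hA : IsPowerSummand R M A) {𝔞 : Ideal R} (h𝔞 : 𝔞 ≠ ⊤)
    (hM : ∀ n, 0 < n → ∀ k, TorVan R M k (R ⧸ 𝔞 ^ n))
    {B : Type u} [Ring B] (φ : A →+* B) (hφ : Function.Surjective φ)
    (hker : ∀ y, φ y = 0 ↔ y ∈ 𝔞 • (⊤ : Submodule R A))
    {e d : ℤ → B} (he : ∀ i, e i * e i = e i) {a b : ℤ} (hab : ∀ i, i ∉ Finset.Icc a b → e i = 0)
    (hd : ∀ i, e (i + 1) * d i = d i) (hd' : ∀ i, d i * e i = d i)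
    (hdd : ∀ i, d (i + 1) * d i = 0)
    (hex : ∀ (k : ℕ), 1 ≤ k → ∀ x : ℤ → B, (∀ i, e (i + (k + 1 : ℕ)) * x i = x i) →
      (∀ i, x i * e i = x i) →
      (∀ i, d (i + (k + 1 : ℕ)) * x i = (-1) ^ (k + 1) * x (i + 1) * d i) →
      ∃ y : ℤ → B, (∀ i, e (i + k) * y i = y i) ∧ (∀ i, y i * e i = y i) ∧
        ∀ i, x i = d (i + k) * y i - (-1) ^ k * y (i + 1) * d i) :
    ∃ E D : ℤ → A, (∀ i, E i * E i = E i) ∧ (∀ i, i ∉ Finset.Icc a b → E i = 0) ∧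
      (∀ i, D i * E i = D i) ∧ (∀ i, D (i + 1) * D i = 0) ∧
      (∀ i, φ (E i) = e i) ∧ ∀ i, φ (D i) = d i := by
  have hE : ∀ i, ∃ E : A, E * E = E ∧ φ E = e i ∧ (i ∉ Finset.Icc a b → E = 0) := by
    intro i
    by_cases hi : i ∈ Finset.Icc a b
    · obtain ⟨x, hx⟩ := hφ (e i)
      obtain ⟨E, h1, h2⟩ := exists_isIdempotentElem h𝔞 x ((hker _).1 (by
        rw [map_sub, map_mul, hx, he, sub_self]))
      refine ⟨E, h1, ?_, fun h => absurd hi h⟩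
      rw [← hx, ← sub_eq_zero, ← map_sub]
      exact (hker _).2 h2
    -- Outside the amplitude the lift is chosen to be zero, which keeps the lifted complex bounded.
    · exact ⟨0, by simp, by simp [hab i hi], fun _ => rfl⟩
  choose E hEE hφE hE0 using hE
  choose z hz using fun i => hφ (d i)
  -- Sandwiching an arbitrary lift between the lifted idempotents makes it a graded map without
  -- changing its reduction.
  have hφd : ∀ i, φ (E (i + 1) * z i * E i) = d i := fun i => by
    rw [map_mul, map_mul, hφE, hφE, hz, hd, hd']
  obtain ⟨D, hD, hDd, hDD⟩ := exists_differential hA h𝔞 hM hEE hE0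
    (d := fun i => E (i + 1) * z i * E i)
    (fun i => by
      rw [Nat.cast_one, ← mul_assoc, ← mul_assoc, hEE, mul_assoc _ (E i), hEE]
      exact ⟨rfl, rfl⟩)
    (fun i => (hker _).1 (by rw [map_mul, hφd, hφd, hdd]))
    (fun k hk x hx hδ => by
      have hδ' := fun i => (hker _).2 (hδ i)
      simp only [map_sub, map_mul φ (_ * _ * _) (x _), map_mul φ (_ * x _) (_ * _ * _),
        map_mul φ _ (x _), hφd, map_pow, map_neg, map_one, sub_eq_zero] at hδ'
      obtain ⟨y, hy1, hy2, hy3⟩ := hex k hk (fun i => φ (x i))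
        (fun i => by rw [← hφE, ← map_mul, (hx i).1])
        (fun i => by rw [← hφE, ← map_mul, (hx i).2]) hδ'
      choose t ht using fun i => hφ (y i)
      have hφy : ∀ i, φ (E (i + k) * t i * E i) = y i := fun i => by
        rw [map_mul, map_mul, hφE, hφE, ht, hy1, hy2]
      refine ⟨fun i => E (i + k) * t i * E i, fun i => ?_, fun i => (hker _).1 ?_⟩
      · rw [← mul_assoc, ← mul_assoc, hEE, mul_assoc _ (E i), hEE]
        exact ⟨rfl, rfl⟩
      · rw [map_sub, map_sub, map_mul φ (E _ * _ * _), map_mul φ (_ * (E _ * _ * _)),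
          map_mul φ _ (E _ * _ * _), hφd, hφd, hφy, hφy, map_pow, map_neg, map_one, hy3, sub_self])
  refine ⟨E, D, hEE, hE0, fun i => (hD i).2, hDD, hφE, fun i => ?_⟩
  rw [← hφd, ← sub_eq_zero, ← map_sub]
  exact (hker _).2 (hDd i)

end LiftComplex

/-! ### Matrices as morphisms, and homotopies between them -/

section MatrixHom

variable {S : Type u} [Ring S] {n : ℕ}

/-- The endomorphism of the object `S ^ n` given by a matrix. -/
def matrixHom (y : Matrix (Fin n) (Fin n) S) :
    ModuleCat.of Sᵐᵒᵖ (Fin n → S) ⟶ ModuleCat.of Sᵐᵒᵖ (Fin n → S) :=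
  ModuleCat.ofHom (matrixMap y)

theorem matrixHom_mul (y z : Matrix (Fin n) (Fin n) S) :
    matrixHom (y * z) = matrixHom z ≫ matrixHom y :=
  ModuleCat.hom_ext (matrixMap_mul y z)

theorem matrixHom_add (y z : Matrix (Fin n) (Fin n) S) :
    matrixHom (y + z) = matrixHom y + matrixHom z :=
  ModuleCat.hom_ext (matrixMap_add y z)

theorem matrixHom_neg (y : Matrix (Fin n) (Fin n) S) : matrixHom (-y) = -matrixHom y :=
  ModuleCat.hom_ext (matrixMap_neg y)

theorem matrixHom_zero : matrixHom (0 : Matrix (Fin n) (Fin n) S) = 0 :=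
  ModuleCat.hom_ext matrixMap_zero

theorem matrixHom_injective : Function.Injective (matrixHom (S := S) (n := n)) := fun _ _ h =>
  matrixMap_injective (ModuleCat.hom_ext_iff.1 h)

theorem matrixHom_surjective : Function.Surjective (matrixHom (S := S) (n := n)) := fun φ => by
  obtain ⟨y, hy⟩ := matrixMap_surjective φ.hom
  exact ⟨y, ModuleCat.hom_ext hy⟩

theorem matrixHom_negOnePow (k : ℕ) (y : Matrix (Fin n) (Fin n) S) :
    (k : ℤ).negOnePow • matrixHom y = matrixHom ((-1) ^ k * y) := by
  induction k with
  | zero => simp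
  | succ k ih =>
    rw [Nat.cast_succ, Int.negOnePow_succ, Units.neg_smul, ih, ← matrixHom_neg]
    congr 1
    rw [pow_succ']
    noncomm_ring

/-- This turns vanishing of $\operatorname{Hom}(K, K[k+1])$ into the exactness hypothesis of the
deformation argument; the signs match since $(-1)^{k+1} = -(-1)^k$. -/
theorem exists_matrix_homotopy [HasDerivedCategory.{w} (RightMod S)]
    (K : CochainComplex (RightMod S) ℤ) (b : ℤ) [K.IsStrictlyLE b] [∀ i, Projective (K.X i)]
    (k : ℕ) (hK : ∀ g : DerivedCategory.Q.obj K ⟶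
      (DerivedCategory.Q.obj K)⟦((k + 1 : ℕ) : ℤ)⟧, g = 0)
    (s : ∀ i, K.X i ⟶ ModuleCat.of Sᵐᵒᵖ (Fin n → S))
    (r : ∀ i, ModuleCat.of Sᵐᵒᵖ (Fin n → S) ⟶ K.X i) (hsr : ∀ i, s i ≫ r i = 𝟙 _)
    {e d : ℤ → Matrix (Fin n) (Fin n) S} (he : ∀ i, matrixHom (e i) = r i ≫ s i)
    (hd : ∀ i, matrixHom (d i) = r i ≫ K.d i (i + 1) ≫ s (i + 1))
    (x : ℤ → Matrix (Fin n) (Fin n) S) (hx : ∀ i, e (i + (k + 1 : ℕ)) * x i = x i)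
    (hx' : ∀ i, x i * e i = x i)
    (hδ : ∀ i, d (i + (k + 1 : ℕ)) * x i = (-1) ^ (k + 1) * x (i + 1) * d i) :
    ∃ y : ℤ → Matrix (Fin n) (Fin n) S, (∀ i, e (i + k) * y i = y i) ∧
      (∀ i, y i * e i = y i) ∧ ∀ i, x i = d (i + k) * y i - (-1) ^ k * y (i + 1) * d i := by
  obtain ⟨y, hy1, hy2, hy3⟩ := exists_homotopy_of_retracts K b (k : ℤ) ((k + 1 : ℕ) : ℤ)
    (by push_cast; ring) hK s r hsr (fun i => matrixHom (d i)) hd (fun i => matrixHom (x i))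
    (fun i => by rw [← Category.assoc, ← he, ← matrixHom_mul, hx'])
    (fun i => by rw [← he, ← matrixHom_mul, hx])
    (fun i => by
      rw [← matrixHom_mul, ← matrixHom_mul, matrixHom_negOnePow, hδ, mul_assoc])
  choose z hz using fun i => matrixHom_surjective (y i)
  refine ⟨z, fun i => matrixHom_injective ?_, fun i => matrixHom_injective ?_,
    fun i => matrixHom_injective ?_⟩
  · rw [matrixHom_mul, hz, he, hy2]
  · rw [matrixHom_mul, hz, he, Category.assoc, hy1]
  · rw [hy3, ← hz, ← hz, ← matrixHom_mul, ← matrixHom_mul, matrixHom_negOnePow, ← matrixHom_add]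
    congr 1
    rw [pow_succ']
    noncomm_ring

end MatrixHom

/-! ### Passing between complexes and matrices -/

section Final

variable {S : Type u} [Ring S]

theorem exists_retracts (K : CochainComplex (RightMod S) ℤ) (a b : ℤ) [K.IsStrictlyGE a]
    [K.IsStrictlyLE b] (hf : ∀ i, Module.Finite Sᵐᵒᵖ (K.X i))
    (hp : ∀ i, Module.Projective Sᵐᵒᵖ (K.X i)) :
    ∃ (n : ℕ) (s : ∀ i, K.X i ⟶ ModuleCat.of Sᵐᵒᵖ (Fin n → S))
      (r : ∀ i, ModuleCat.of Sᵐᵒᵖ (Fin n → S) ⟶ K.X i), (∀ i, s i ≫ r i = 𝟙 _) ∧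
      ∀ i, i ∉ Finset.Icc a b → r i = 0 := by
  choose m hm using fun i => exists_retract (S := S) (K.X i)
  have hz : ∀ i, i ∉ Finset.Icc a b → Limits.IsZero (K.X i) := by
    intro i hi
    rw [Finset.mem_Icc, not_and_or, not_le, not_le] at hi
    obtain hi | hi := hi
    · exact K.isZero_of_isStrictlyGE a i hi
    · exact K.isZero_of_isStrictlyLE b i hi
  have : ∀ i, ∃ (s : K.X i ⟶ ModuleCat.of Sᵐᵒᵖ (Fin ((Finset.Icc a b).sup m) → S))
      (r : ModuleCat.of Sᵐᵒᵖ (Fin ((Finset.Icc a b).sup m) → S) ⟶ K.X i), s ≫ r = 𝟙 _ := by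
    intro i
    by_cases hi : i ∈ Finset.Icc a b
    · obtain ⟨s, r, h⟩ := hm i _ (Finset.le_sup hi)
      exact ⟨ModuleCat.ofHom s, ModuleCat.ofHom r, ModuleCat.hom_ext h⟩
    · exact ⟨0, 0, (hz i hi).eq_of_src _ _⟩
  choose s r h using this
  exact ⟨_, s, r, h, fun i hi => (hz i hi).eq_of_tgt _ _⟩

theorem SiltGE.eq_zero_of_iso [HasDerivedCategory.{w} (RightMod S)]
    {P Q : DerivedCategory (RightMod S)} (p : Q ≅ P) (h : SiltGE P (P⟦(1 : ℤ)⟧)) (k : ℤ)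
    (hk : 1 < k) (g : Q ⟶ Q⟦k⟧) : g = 0 := by
  let c : P⟦k⟧ ≅ (P⟦(1 : ℤ)⟧)⟦k - 1⟧ :=
    (shiftFunctorAdd' (DerivedCategory (RightMod S)) 1 (k - 1) k (by ring)).app P
  have h1 := h (k - 1) (by omega) (p.inv ≫ g ≫ (p.hom⟦k⟧' : Q⟦k⟧ ⟶ P⟦k⟧) ≫ c.hom)
  have : IsIso (p.hom⟦k⟧') := inferInstance
  rw [← cancel_epi p.inv, ← cancel_mono (p.hom⟦k⟧'), ← cancel_mono c.hom]
  simpa using h1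

theorem SiltGE.shift_one [HasDerivedCategory.{w} (RightMod S)]
    {P : DerivedCategory (RightMod S)} (h : SiltGE P P) : SiltGE P (P⟦(1 : ℤ)⟧) := by
  intro i hi g
  let c : P⟦1 + i⟧ ≅ (P⟦(1 : ℤ)⟧)⟦i⟧ :=
    (shiftFunctorAdd' (DerivedCategory (RightMod S)) 1 i (1 + i) rfl).app P
  rw [← cancel_mono c.inv, Limits.zero_comp]
  exact h (1 + i) (by omega) _

theorem exists_complex_of_matrices {n : ℕ} {e d : ℤ → Matrix (Fin n) (Fin n) S}
    (he : ∀ i, e i * e i = e i) {a b : ℤ} (hab : ∀ i, i ∉ Finset.Icc a b → e i = 0)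
    (hd : ∀ i, d i * e i = d i) (hdd : ∀ i, d (i + 1) * d i = 0) :
    ∃ (L : CochainComplex (RightMod S) ℤ) (ι : ∀ i, L.X i ⟶ ModuleCat.of Sᵐᵒᵖ (Fin n → S))
      (π : ∀ i, ModuleCat.of Sᵐᵒᵖ (Fin n → S) ⟶ L.X i), L.IsStrictlyGE a ∧ L.IsStrictlyLE b ∧
      (∀ i, Module.Finite Sᵐᵒᵖ (L.X i) ∧ Module.Projective Sᵐᵒᵖ (L.X i)) ∧
      (∀ i, ι i ≫ π i = 𝟙 _) ∧ (∀ i, π i ≫ ι i = matrixHom (e i)) ∧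
      ∀ i, L.d i (i + 1) = ι i ≫ matrixHom (d i) ≫ π (i + 1) := by
  let X : ℤ → RightMod S := fun i => ModuleCat.of Sᵐᵒᵖ (LinearMap.range (matrixMap (e i)))
  let ι : ∀ i, X i ⟶ ModuleCat.of Sᵐᵒᵖ (Fin n → S) := fun i =>
    ModuleCat.ofHom (LinearMap.range (matrixMap (e i))).subtype
  let π : ∀ i, ModuleCat.of Sᵐᵒᵖ (Fin n → S) ⟶ X i := fun i =>
    ModuleCat.ofHom (matrixMap (e i)).rangeRestrict
  have hιπ : ∀ i, (matrixMap (e i)).rangeRestrict ∘ₗ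
      (LinearMap.range (matrixMap (e i))).subtype = LinearMap.id := fun i => by
    ext1 ⟨_, v, rfl⟩
    refine Subtype.ext ?_
    change (matrixMap (e i) ∘ₗ matrixMap (e i)) v = matrixMap (e i) v
    rw [← matrixMap_mul, he]
  have hπι : ∀ i, π i ≫ ι i = matrixHom (e i) := fun i => rfl
  let L : CochainComplex (RightMod S) ℤ := CochainComplex.of X
    (fun i => ι i ≫ matrixHom (d i) ≫ π (i + 1)) fun i => by
      have h1 : (ι i ≫ matrixHom (d i) ≫ π (i + 1)) ≫ ι (i + 1) ≫ matrixHom (d (i + 1)) ≫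
          π (i + 1 + 1) = ι i ≫ (matrixHom (d i) ≫ (π (i + 1) ≫ ι (i + 1)) ≫
          matrixHom (d (i + 1))) ≫ π (i + 1 + 1) := by simp only [Category.assoc]
      -- The idempotent between the two differentials is absorbed by `d (i + 1)`, which leaves `d (i
      -- + 1) * d i`.
      rw [h1, hπι, ← matrixHom_mul, ← matrixHom_mul, hd, hdd, matrixHom_zero]
      simp
  have hzero : ∀ i, i ∉ Finset.Icc a b → Limits.IsZero (X i) := fun i hi => by
    rw [Limits.IsZero.iff_id_eq_zero]
    refine ModuleCat.hom_ext (LinearMap.ext ?_)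
    rintro ⟨_, v, rfl⟩
    refine Subtype.ext ?_
    change matrixMap (e i) v = 0
    rw [hab i hi, matrixMap_zero, LinearMap.zero_apply]
  refine ⟨L, ι, π, ?_, ?_, fun i => ⟨?_, ?_⟩, fun i => ModuleCat.hom_ext (hιπ i), hπι,
    fun i => CochainComplex.of_d X (fun i => ι i ≫ matrixHom (d i) ≫ π (i + 1)) i⟩
  · rw [CochainComplex.isStrictlyGE_iff]
    exact fun i hi => hzero i fun h => by rw [Finset.mem_Icc] at h; omega
  · rw [CochainComplex.isStrictlyLE_iff]
    exact fun i hi => hzero i fun h => by rw [Finset.mem_Icc] at h; omega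
  · exact Module.Finite.range (matrixMap (e i))
  · have : Module.Projective Sᵐᵒᵖ (Fin n → S) :=
      Module.Projective.of_equiv (LinearEquiv.piCongrRight fun _ => (selfEquivOp S).symm)
    exact Module.Projective.of_split _ _ (hιπ i)

end Final

/-! ### The quotient algebra and the lifted complex -/

section Quotient

variable {R : Type u} [CommRing R] {Λ : Type u} [Ring Λ] [Algebra R Λ] {𝔞 : Ideal R} {n : ℕ}

/-- The image of $R$ is central, so the left ideal generated by `𝔞` is the $R$-submodule $\mathfrak
a \Lambda$. -/
theorem mem_extIdeal_iff {x : Λ} : x ∈ extIdeal Λ 𝔞 ↔ x ∈ 𝔞 • (⊤ : Submodule R Λ) := by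
  constructor
  · intro h
    refine Submodule.span_induction (p := fun x _ => x ∈ 𝔞 • (⊤ : Submodule R Λ)) ?_ ?_ ?_ ?_ h
    · rintro _ ⟨r, hr, rfl⟩
      rw [Algebra.algebraMap_eq_smul_one]
      exact Submodule.smul_mem_smul hr trivial
    · exact zero_mem _
    · exact fun _ _ _ _ => add_mem
    · exact fun c x _ hx => mul_mem_smul_top_left c hx
  · intro h
    induction h using Submodule.smul_induction_on' with
    | smul r hr x _ =>
      rw [Algebra.smul_def, Algebra.commutes]
      exact Ideal.mul_mem_left _ _ (Ideal.mem_map_of_mem _ hr)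
    | add x _ y _ hx hy => exact add_mem hx hy

theorem mapMatrix_mk_eq_zero_iff {y : Matrix (Fin n) (Fin n) Λ} :
    (Ideal.Quotient.mk (extIdeal Λ 𝔞)).mapMatrix y = 0 ↔
      y ∈ 𝔞 • (⊤ : Submodule R (Matrix (Fin n) (Fin n) Λ)) := by
  rw [← Matrix.ext_iff]
  simp only [RingHom.mapMatrix_apply, Matrix.map_apply, Matrix.zero_apply,
    Ideal.Quotient.eq_zero_iff_mem, mem_extIdeal_iff]
  rw [show y ∈ 𝔞 • (⊤ : Submodule R (Matrix (Fin n) (Fin n) Λ)) ↔ ∀ i, y i ∈ 𝔞 •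
    (⊤ : Submodule R (Fin n → Λ)) from pi_mem_smul_top_iff]
  simp only [pi_mem_smul_top_iff]

theorem isPowerSummand_matrix : IsPowerSummand R Λ (Matrix (Fin n) (Fin n) Λ) := by
  refine ⟨Fin n × Fin n, inferInstance, fun p => Matrix.entryLinearMap R Λ p.1 p.2,
    fun p => Matrix.singleLinearMap R p.1 p.2, LinearMap.ext fun y => ?_⟩
  rw [Fintype.sum_prod_type]
  simpa [LinearMap.sum_apply] using (Matrix.matrix_eq_sum_single y).symm

variable [IsNoetherianRing R] [IsLocalRing R] [IsAdicComplete (IsLocalRing.maximalIdeal R) R]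
  [Module.Finite R Λ]

theorem exists_perfect_lift (h𝔞 : 𝔞 ≠ ⊤) [HasDerivedCategory.{w} (RightMod Λ)]
    [HasDerivedCategory.{w'} (RightMod (Λ ⧸ extIdeal Λ 𝔞))]
    (hTor : ∀ n : ℕ, 0 < n → TorPosVanishes R Λ (R ⧸ 𝔞 ^ n))
    (P : DerivedCategory (RightMod (Λ ⧸ extIdeal Λ 𝔞))) (hP : IsPerfect P)
    (hPP : SiltGE P (P⟦(1 : ℤ)⟧)) :
    ∃ L : DerivedCategory (RightMod Λ), IsPerfect L ∧
      IsDerivedTensor (Ideal.Quotient.mk (extIdeal Λ 𝔞)) L P := by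
  obtain ⟨K, ⟨a, b, _, _⟩, hK, ⟨p⟩⟩ := hP
  have hproj : ∀ i, Projective (K.X i) := fun i =>
    (IsProjective.iff_projective (K.X i)).1 (hK i).2
  obtain ⟨n, s, r, hsr, hr⟩ := exists_retracts K a b (fun i => (hK i).1) (fun i => (hK i).2)
  choose e he using fun i => matrixHom_surjective (r i ≫ s i)
  choose d hd using fun i => matrixHom_surjective (r i ≫ K.d i (i + 1) ≫ s (i + 1))
  have : Module.Finite R (Matrix (Fin n) (Fin n) Λ) :=
    inferInstanceAs (Module.Finite R (Fin n → Fin n → Λ))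
  obtain ⟨E, D, hE, hE0, hDE, hDD, hφE, hφD⟩ := exists_lift_idempotents_differential
    (isPowerSummand_matrix (R := R) (Λ := Λ) (n := n)) h𝔞
    (fun n hn k => TorVan.of_torPosVanishes (hTor n hn) k)
    (Ideal.Quotient.mk (extIdeal Λ 𝔞)).mapMatrix
    (fun y => by
      choose z hz using fun i j => Ideal.Quotient.mk_surjective (y i j)
      exact ⟨Matrix.of z, by ext i j; exact hz i j⟩)
    (fun y => mapMatrix_mk_eq_zero_iff) (e := e) (d := d) (a := a) (b := b)
    (fun i => matrixHom_injective (by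
      rw [matrixHom_mul, he, Category.assoc, reassoc_of% hsr i]))
    (fun i hi => matrixHom_injective (by rw [he, hr i hi, Limits.zero_comp, matrixHom_zero]))
    (fun i => matrixHom_injective (by
      rw [matrixHom_mul, he, hd]
      simp only [Category.assoc, reassoc_of% hsr (i + 1)]))
    (fun i => matrixHom_injective (by
      rw [matrixHom_mul, he, hd]
      simp only [Category.assoc, reassoc_of% hsr i]))
    (fun i => matrixHom_injective (by
      rw [matrixHom_mul, hd, hd, matrixHom_zero]
      simp only [Category.assoc, reassoc_of% hsr (i + 1)]
      simp))
    -- As `k ≥ 1`, only $\operatorname{Hom}(P, P[k+1])$ with $k + 1 \geq 2$ is needed, which is what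
    -- $P \geq P[1]$ provides.
    (fun k hk x h1 h2 h3 => exists_matrix_homotopy K b k
      (fun g => hPP.eq_zero_of_iso p _ (by omega) g) s r hsr he hd x h1 h2 h3)
  obtain ⟨L, ι, π, ha, hb, hL, hιπ, hπι, hLd⟩ := exists_complex_of_matrices hE hE0 hDE hDD
  obtain ⟨c⟩ := nonempty_iso_of_retracts (extendScalars (Ideal.Quotient.mk (extIdeal Λ 𝔞))) L K
    (extendScalarsFree (Ideal.Quotient.mk (extIdeal Λ 𝔞)) n) ι π hιπ s r hsr
    (fun i => by
      rw [hπι, ← he, ← hφE]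
      exact extendScalars_map_matrixMap _ n (E i))
    (fun i => matrixHom (D i)) hLd
    (fun i => by
      rw [← hd, ← hφD]
      exact extendScalars_map_matrixMap _ n (D i))
  -- `L` is itself a bounded complex of projectives, so it computes its own derived tensor product.
  exact ⟨DerivedCategory.Q.obj L, ⟨L, ⟨a, b, ha, hb⟩, hL, ⟨Iso.refl _⟩⟩,
    L, ⟨b, hb⟩, fun i => (hL i).2, ⟨Iso.refl _⟩, ⟨DerivedCategory.Q.mapIso c ≪≫ p⟩⟩

end Quotient

end SiltingLift

end

theorem mainTheorem7
    (R : Type u) [CommRing R] [IsNoetherianRing R] [IsLocalRing R]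
    [IsAdicComplete (IsLocalRing.maximalIdeal R) R]
    (Λ : Type u) [Ring Λ] [Algebra R Λ] [Module.Finite R Λ]
    (𝔞 : Ideal R) (h𝔞 : 𝔞 ≠ ⊤)
    [HasDerivedCategory.{w} (SiltingLift.RightMod Λ)]
    [HasDerivedCategory.{w'} (SiltingLift.RightMod (Λ ⧸ SiltingLift.extIdeal Λ 𝔞))]
    (hTor : ∀ n : ℕ, 0 < n → SiltingLift.TorPosVanishes R Λ (R ⧸ 𝔞 ^ n)) :
    (∀ P : DerivedCategory (SiltingLift.RightMod (Λ ⧸ SiltingLift.extIdeal Λ 𝔞)),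
      SiltingLift.IsPerfect P → SiltingLift.SiltGE P (P⟦(1 : ℤ)⟧) →
      ∃ L : DerivedCategory (SiltingLift.RightMod Λ), SiltingLift.IsPerfect L ∧
        SiltingLift.IsDerivedTensor (Ideal.Quotient.mk (SiltingLift.extIdeal Λ 𝔞)) L P) ∧
    (∀ P : DerivedCategory (SiltingLift.RightMod (Λ ⧸ SiltingLift.extIdeal Λ 𝔞)),
      SiltingLift.IsPresilting P →
      ∃ L : DerivedCategory (SiltingLift.RightMod Λ), SiltingLift.IsPerfect L ∧
        SiltingLift.IsDerivedTensor (Ideal.Quotient.mk (SiltingLift.extIdeal Λ 𝔞)) L P) := by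
  exact ⟨fun P hP hPP => SiltingLift.exists_perfect_lift h𝔞 hTor P hP hPP, fun P hP =>
    SiltingLift.exists_perfect_lift h𝔞 hTor P hP.1 hP.2.shift_one⟩
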